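/- Let $0<c<1$, let $d\ge 1$ be a real number, and let $\alpha>1$ be a non-integer. Let $T\ge 0$ be a random variable with $\mathbb{E}T=d$, let $N=(N(t))_{t\ge0}$ be a Poisson process of rate $1$ independent of $T$, and let $R\ge0$ be a random variable with $\mathbb{E}R<\infty$ which satisfies $$R\ \stackrel{d}{=}\ \frac{c}{d}\sum_{j=1}^{N(T)}R_j+(1-c),$$ where $R_1,R_2,\dots$ are independent, distributed as $R$, and independent of $N(T)$. Let $L$ be a slowly varying function, i.e. $L(tx)/L(x)\to1$ as $x\to\infty$ for every $t>0$. Then the following are equivalent: (i) $\mathbb{P}(N(T)>x)\sim x^{-\alpha}L(x)$ as $x\to\infty$; (ii) $\mathbb{P}(R>x)\sim \dfrac{c^{\alpha}}{d^{\alpha}-c^{\alpha}d}\,x^{-\alpha}L(x)$ as $x\to\infty$. Here $a(x)\sim b(x)$ means $a(x)/b(x)\to1$. -/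

import Mathlib

open MeasureTheory ProbabilityTheory Filter Asymptotics
open scoped NNReal Topology

/-- `L` is slowly varying (at infinity): for every `t > 0`, `L (t x) / L x → 1` as `x → ∞`.
The case `t = 1` forces `L x ≠ 0` for all large `x`. -/
def IsSlowlyVarying (L : ℝ → ℝ) : Prop :=
  ∀ t : ℝ, 0 < t → Tendsto (fun x => L (t * x) / L x) atTop (𝓝 1)

/-- The complementary distribution function `x ↦ P(X > x)` of a real random variable. -/
noncomputable def tailFun {Ω : Type*} [MeasurableSpace Ω] (P : Measure Ω) (X : Ω → ℝ) (x : ℝ) : ℝ :=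
  P.real {ω | x < X ω}

/-- `N` is a (homogeneous) Poisson process of rate `1` on `[0, ∞)`: a counting process started
at `0`, almost surely with nondecreasing right-continuous paths, with independent increments,
the increment over `(s, t]` being Poisson distributed with parameter `t - s`. Since paths are
nondecreasing, the subtraction of natural numbers below is the true one almost surely. -/
structure IsUnitPoissonProcess {Ω : Type*} [MeasurableSpace Ω] (N : ℝ≥0 → Ω → ℕ)
    (P : Measure Ω) : Prop where
  measurable : ∀ t, Measurable (N t)
  start : ∀ᵐ ω ∂P, N 0 ω = 0
  mono : ∀ᵐ ω ∂P, Monotone (fun t => N t ω)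
  rightCont : ∀ᵐ ω ∂P, ∀ t, ContinuousWithinAt (fun s => N s ω) (Set.Ici t) t
  indep : HasIndepIncrements N P
  law : ∀ s t, s ≤ t → HasLaw (fun ω => N t ω - N s ω) (poissonMeasure (t - s)) P

/-- The law of `R` (a random variable on the probability space `(Ω', P')`) solves
`R =_d (c / d) * ∑_{j = 1}^{M} R_j + (1 - c)`, where the `R_j` are i.i.d. copies of `R`,
independent of the random number `M` of summands; here `M` and the `R_j` (numbered from `0`)
live on `(Ω, P)`. -/
structure SolvesPageRankEq {Ω Ω' : Type*} [MeasurableSpace Ω] [MeasurableSpace Ω']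
    (c d : ℝ) (M : Ω → ℕ) (Rs : ℕ → Ω → ℝ) (P : Measure Ω) (R : Ω' → ℝ) (P' : Measure Ω') :
    Prop where
  copies : ∀ j, IdentDistrib (Rs j) R P P'
  iindep : iIndepFun Rs P
  indep : IndepFun (fun ω j => Rs j ω) M P
  eq : IdentDistrib R (fun ω => c / d * (∑ j ∈ Finset.range (M ω), Rs j ω) + (1 - c)) P' P

/-! Let M = N(T), with tail U; let V be the tail of R and W that of S = R_1 + ... + R_M. Sampling
the Poisson process at T gives E M = d, and taking expectations in the equation then forces E R = 1.
The equation itself says V((c/d)x + 1 - c) = W(x).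

A large S has two likely causes: one huge summand, with probability about d V(x), or M > x, where
the law of large numbers puts S close to M. So W(x) is about U(x) + d V(x), up to factors 1 ± ε in
the arguments; the two halves are `W_eventually_le` and `eventually_le_W`. The delicate region is M
≤ ηx: there `tailFun_sum_le` separates one big jump from a Chernoff term, and a truncated moment of
M makes that term O(η) times the target tail.

If V is regularly varying, U(x) is about V((c/d)x) - d V(x), which gives the ratio at once
(`tendsto_U_div_V`). If U is, the unknown V stands on both sides, but the equation is a contraction,
since d (d/c)^(-α) < c < 1. This yields V = O(U), starting from Markov's V(x) ≤ 1/x (`exists_V_le`),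
and then drives V/U to the fixed point of g = (1 + d g)(d/c)^(-α), namely g = 1/((d/c)^α - d)
(`tendsto_V_div_U`). -/

/-! ### Regularly varying tails. -/

/-- A positive nonincreasing function, bounded by `1`, which is regularly varying of index `-α`. -/
structure IsRVTail (α : ℝ) (H : ℝ → ℝ) : Prop where
  anti : Antitone H
  pos : ∀ x, 0 < H x
  le_one : ∀ x, H x ≤ 1
  ratio : ∀ t : ℝ, 0 < t → Tendsto (fun x => H (t * x) / H x) atTop (𝓝 (t ^ (-α)))

namespace IsRVTail

variable {α : ℝ} {H : ℝ → ℝ}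

/-- Monotonicity replaces uniform convergence: `f x` is eventually on one side of `s * x` for `s`
near `t`, and `s ^ (-α)` is continuous in `s`. -/
theorem tendsto_comp_div (hH : IsRVTail α H) {f : ℝ → ℝ} {t : ℝ} (ht : 0 < t)
    (hf : Tendsto (fun x => f x / x) atTop (𝓝 t)) :
    Tendsto (fun x => H (f x) / H x) atTop (𝓝 (t ^ (-α))) := by
  have hcont : ContinuousAt (fun s : ℝ => s ^ (-α)) t :=
    Real.continuousAt_rpow_const _ _ (Or.inl ht.ne')
  rw [tendsto_order]
  constructor
  · intro a ha
    have h1 : ∀ᶠ s in 𝓝[>] t, a < s ^ (-α) :=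
      (hcont.eventually (lt_mem_nhds ha)).filter_mono nhdsWithin_le_nhds
    obtain ⟨s, hs, hts⟩ := (h1.and self_mem_nhdsWithin).exists
    have hts : t < s := hts
    filter_upwards [(hH.ratio s (ht.trans hts)).eventually (lt_mem_nhds hs),
      hf.eventually (gt_mem_nhds hts), eventually_gt_atTop 0] with x hx h2 hx0
    refine hx.trans_le ?_
    rw [div_lt_iff₀ hx0] at h2
    exact div_le_div_of_nonneg_right (hH.anti h2.le) (hH.pos x).le
  · intro a ha
    have h1 : ∀ᶠ s in 𝓝[<] t, s ^ (-α) < a :=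
      (hcont.eventually (gt_mem_nhds ha)).filter_mono nhdsWithin_le_nhds
    have h0 : ∀ᶠ s in 𝓝[<] t, 0 < s :=
      (lt_mem_nhds ht).filter_mono nhdsWithin_le_nhds
    obtain ⟨s, ⟨hs, hs0⟩, hts⟩ := ((h1.and h0).and self_mem_nhdsWithin).exists
    have hts : s < t := hts
    filter_upwards [(hH.ratio s hs0).eventually (gt_mem_nhds hs),
      hf.eventually (lt_mem_nhds hts), eventually_gt_atTop 0] with x hx h2 hx0
    refine lt_of_le_of_lt ?_ hx
    rw [lt_div_iff₀ hx0] at h2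
    exact div_le_div_of_nonneg_right (hH.anti h2.le) (hH.pos x).le

/-- A Potter-type bound. -/
theorem exists_pow_mul_le (hH : IsRVTail α H) {k : ℕ} (hk : α < k) :
    ∃ C : ℝ, 0 < C ∧ ∀ y x, 0 ≤ y → y ≤ x → (y + 1) ^ k * H y ≤ C * ((x + 1) ^ k * H x) := by
  -- Since k > α, one doubling costs less than a factor 2^k far out; iterating over dyadic scales
  -- gives the bound beyond `x₀`.
  have h2 : (2 : ℝ) ^ (-(k : ℝ)) < 2 ^ (-α) :=
    Real.rpow_lt_rpow_of_exponent_lt (by norm_num) (by linarith)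
  have h3 := (hH.ratio 2 (by norm_num)).eventually (lt_mem_nhds h2)
  obtain ⟨x₀, hx₀⟩ := (h3.and (eventually_ge_atTop 1)).exists_forall_of_atTop
  have hx₀1 : 1 ≤ x₀ := (hx₀ x₀ le_rfl).2
  have hdbl : ∀ x, x₀ ≤ x → H x ≤ 2 ^ k * H (2 * x) := by
    intro x hx
    have := (hx₀ x hx).1
    rw [Real.rpow_neg (by norm_num), Real.rpow_natCast, lt_div_iff₀ (hH.pos x),
      inv_mul_lt_iff₀ (by positivity)] at this
    exact this.le
  have hiter : ∀ (n : ℕ) (x : ℝ), x₀ ≤ x → H x ≤ 2 ^ (n * k) * H (2 ^ n * x) := by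
    intro n
    induction n with
    | zero => intro x _; simp
    | succ n ih =>
      intro x hx
      have h1 : x₀ ≤ 2 ^ n * x :=
        hx.trans (le_mul_of_one_le_left (by linarith) (one_le_pow₀ (by norm_num)))
      calc H x ≤ 2 ^ (n * k) * H (2 ^ n * x) := ih x hx
        _ ≤ 2 ^ (n * k) * (2 ^ k * H (2 * (2 ^ n * x))) := by gcongr; exact hdbl _ h1
        _ = 2 ^ ((n + 1) * k) * H (2 ^ (n + 1) * x) := by
          rw [show 2 * (2 ^ n * x) = 2 ^ (n + 1) * x by ring]; ring
  have hbig : ∀ y x, x₀ ≤ y → y ≤ x → H y ≤ 2 ^ k * (x / y) ^ k * H x := by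
    intro y x hy hyx
    have hy0 : 0 < y := by linarith
    obtain ⟨n, hn1, hn2⟩ := exists_nat_pow_near ((one_le_div hy0).2 hyx) (by norm_num : (1:ℝ) < 2)
    rw [le_div_iff₀ hy0] at hn1
    rw [div_lt_iff₀ hy0] at hn2
    calc H y ≤ 2 ^ ((n + 1) * k) * H (2 ^ (n + 1) * y) := hiter (n + 1) y hy
      _ ≤ 2 ^ ((n + 1) * k) * H x := by gcongr; exact hH.anti hn2.le
      _ = 2 ^ k * (2 ^ n) ^ k * H x := by rw [add_mul, pow_add, pow_mul]; ring
      _ ≤ 2 ^ k * (x / y) ^ k * H x := by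
        have := (hH.pos x).le
        gcongr
        rwa [le_div_iff₀ hy0]
  -- 4^k serves y ≥ `x₀`; the quotient pays for y < `x₀`, where H ≤ 1 is the only information.
  refine ⟨4 ^ k * ((x₀ + 1) ^ k / H x₀ + 1), by have := hH.pos x₀; positivity, ?_⟩
  have hlarge : ∀ y x, x₀ ≤ y → y ≤ x → (y + 1) ^ k * H y ≤ 4 ^ k * ((x + 1) ^ k * H x) := by
    intro y x hy hyx
    have hy0 : 0 < y := by linarith
    calc (y + 1) ^ k * H y ≤ (y + 1) ^ k * (2 ^ k * (x / y) ^ k * H x) := by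
          gcongr; exact hbig y x hy hyx
      _ = ((y + 1) * (2 * (x / y))) ^ k * H x := by rw [mul_pow, mul_pow]; ring
      _ ≤ (4 * (x + 1)) ^ k * H x := by
        have := (hH.pos x).le
        have hx0 : 0 ≤ x := hy0.le.trans hyx
        have h1 : 0 ≤ (y + 1) * (2 * (x / y)) := by positivity
        refine mul_le_mul_of_nonneg_right (pow_le_pow_left₀ h1 ?_ k) this
        rw [mul_div_assoc', mul_div_assoc', div_le_iff₀ hy0]
        nlinarith
      _ = 4 ^ k * ((x + 1) ^ k * H x) := by rw [mul_pow]; ring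
  intro y x hy hyx
  have hx0 := hH.pos x₀
  have hxp := hH.pos x
  have hA : 0 ≤ (x + 1) ^ k * H x := by
    have : 0 ≤ x + 1 := by linarith
    positivity
  have h4 : (1 : ℝ) ≤ 4 ^ k := one_le_pow₀ (by norm_num)
  have hq : 0 ≤ (x₀ + 1) ^ k / H x₀ := by positivity
  rcases le_total x₀ y with h | h
  · refine (hlarge y x h hyx).trans ?_
    gcongr
    nlinarith
  · have hsmall : (y + 1) ^ k * H y ≤ (x₀ + 1) ^ k := by
      calc (y + 1) ^ k * H y ≤ (x₀ + 1) ^ k * 1 := by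
            have := hH.le_one y
            have := (hH.pos y).le
            gcongr
        _ = _ := mul_one _
    rcases le_total x₀ x with hx | hx
    · calc (y + 1) ^ k * H y ≤ (x₀ + 1) ^ k := hsmall
        _ = (x₀ + 1) ^ k / H x₀ * H x₀ := by field_simp
        _ ≤ (x₀ + 1) ^ k / H x₀ * ((x₀ + 1) ^ k * H x₀) := by
          gcongr
          exact le_mul_of_one_le_left hx0.le (one_le_pow₀ (by linarith))
        _ ≤ (x₀ + 1) ^ k / H x₀ * (4 ^ k * ((x + 1) ^ k * H x)) := by
          exact mul_le_mul_of_nonneg_left (hlarge x₀ x le_rfl hx) hq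
        _ ≤ 4 ^ k * ((x₀ + 1) ^ k / H x₀ + 1) * ((x + 1) ^ k * H x) := by
          nlinarith [mul_nonneg (by positivity : (0 : ℝ) ≤ 4 ^ k) hA]
    · calc (y + 1) ^ k * H y ≤ (x₀ + 1) ^ k := hsmall
        _ = (x₀ + 1) ^ k / H x₀ * H x₀ := by field_simp
        _ ≤ (x₀ + 1) ^ k / H x₀ * ((x + 1) ^ k * H x) := by
          gcongr
          refine (hH.anti hx).trans (le_mul_of_one_le_left hxp.le (one_le_pow₀ (by linarith)))
        _ ≤ 4 ^ k * ((x₀ + 1) ^ k / H x₀ + 1) * ((x + 1) ^ k * H x) := by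
          gcongr
          nlinarith

theorem eventually_le (hH : IsRVTail α H) {t : ℝ} (ht : 0 < t) :
    ∀ᶠ x in atTop, H (t * x) ≤ 2 * t ^ (-α) * H x := by
  have h : t ^ (-α) < 2 * t ^ (-α) := by
    have := Real.rpow_pos_of_pos ht (-α)
    linarith
  filter_upwards [(hH.ratio t ht).eventually (gt_mem_nhds h)] with x hx
  exact ((div_lt_iff₀ (hH.pos x)).1 hx).le

end IsRVTail

/-- The free constant `K` lets the same lemma serve both sides of the equivalence. -/
theorem IsSlowlyVarying.tendsto_ratio {L G : ℝ → ℝ} {α K : ℝ} (hL : IsSlowlyVarying L)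
    (hK : K ≠ 0) (hG : G ~[atTop] fun x => K * (x ^ (-α) * L x)) {t : ℝ} (ht : 0 < t) :
    Tendsto (fun x => G (t * x) / G x) atTop (𝓝 (t ^ (-α))) := by
  have hL0 : ∀ᶠ x in atTop, L x ≠ 0 := by
    have := (hL 1 one_pos).eventually_ne one_ne_zero
    filter_upwards [this] with x hx h0
    simp [h0] at hx
  have hne : ∀ᶠ x in atTop, K * (x ^ (-α) * L x) ≠ 0 := by
    filter_upwards [hL0, eventually_gt_atTop 0] with x hx hx0
    exact mul_ne_zero hK (mul_ne_zero (Real.rpow_pos_of_pos hx0 _).ne' hx)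
  have htx : Tendsto (fun x : ℝ => t * x) atTop atTop := tendsto_id.const_mul_atTop ht
  have h := (hG.comp_tendsto htx).div hG
  refine (h.symm.tendsto_nhds ?_)
  have h1 : Tendsto (fun x => t ^ (-α) * (L (t * x) / L x)) atTop (𝓝 (t ^ (-α) * 1)) :=
    (hL t ht).const_mul _
  rw [mul_one] at h1
  refine h1.congr' ?_
  filter_upwards [hL0, eventually_gt_atTop 0] with x hx hx0
  have hxp := (Real.rpow_pos_of_pos hx0 (-α)).ne'
  simp only [Function.comp, Pi.div_apply]
  rw [Real.mul_rpow ht.le hx0.le]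
  field_simp

theorem IsSlowlyVarying.isRVTail {L G : ℝ → ℝ} {α K : ℝ} (hL : IsSlowlyVarying L)
    (hK : K ≠ 0) (hG : G ~[atTop] fun x => K * (x ^ (-α) * L x))
    (hanti : Antitone G) (h0 : ∀ x, 0 ≤ G x) (h1 : ∀ x, G x ≤ 1) : IsRVTail α G := by
  refine ⟨hanti, fun x => ?_, h1, fun t ht => hL.tendsto_ratio hK hG ht⟩
  refine lt_of_le_of_ne (h0 x) fun hx => ?_
  -- A zero of `G` would persist to the right, and the quotient at t = 1 would be 0 / 0 = 0 instead
  -- of tending to 1.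
  have h := hL.tendsto_ratio hK hG one_pos
  rw [Real.one_rpow] at h
  obtain ⟨y, hy, hxy⟩ := ((h.eventually_ne one_ne_zero).and (eventually_ge_atTop x)).exists
  have : G y = 0 := le_antisymm ((hanti hxy).trans hx.ge) (h0 y)
  simp [this] at hy

/-! ### Asymptotics of the tail of a random sum. -/

/-- The analytic data of a random sum of i.i.d. nonnegative variables of mean `1`: `p` is the law
of the number of summands (of mean `d`) and `U` its tail, `V` is the tail of one summand, `F n` that
of the sum of `n` summands, and `W` that of the random sum. -/
structure CompoundTail (d : ℝ) (p : ℕ → ℝ) (F : ℕ → ℝ → ℝ) (U V W : ℝ → ℝ) : Prop where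
  p_nonneg : ∀ n, 0 ≤ p n
  sum_p : HasSum p 1
  sum_mul_p : HasSum (fun n : ℕ => n * p n) d
  U_eq : ∀ z, 0 ≤ z → U z = 1 - ∑ n ∈ Finset.range (⌊z⌋₊ + 1), p n
  V_nonneg : ∀ x, 0 ≤ V x
  V_le_one : ∀ x, V x ≤ 1
  V_le_inv : ∀ x, 0 < x → V x ≤ 1 / x
  F_nonneg : ∀ n x, 0 ≤ F n x
  F_le_one : ∀ n x, F n x ≤ 1
  F_anti : ∀ n, Antitone (F n)
  F_le : ∀ (n : ℕ) (x δ : ℝ) (q : ℕ), 0 < x → 0 < δ → 0 < q → (n : ℝ) ≤ x →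
    F n x ≤ n * V ((1 - δ) * x) + n * V (x / q) * (n / (δ * x)) + (Real.exp 1 * n / x) ^ q
  le_F : ∀ (n : ℕ) (x : ℝ), 0 ≤ x → n * V x - (n * V x) ^ 2 ≤ F n x
  F_above : ∀ s : ℝ, 1 < s → Tendsto (fun n : ℕ => F n (s * n)) atTop (𝓝 0)
  F_below : ∀ s : ℝ, s < 1 → Tendsto (fun n : ℕ => F n (s * n)) atTop (𝓝 1)
  sum_W : ∀ x, HasSum (fun n => p n * F n x) (W x)

/-- Telescoping of (j+1)^(k+1) - j^(k+1) ≤ (k+1)(j+1)^k; it prepares the summation by parts for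
truncated moments. -/
theorem pow_succ_le_sum (k n : ℕ) :
    (n : ℝ) ^ (k + 1) ≤ ∑ j ∈ Finset.range n, (k + 1) * ((j : ℝ) + 1) ^ k := by
  have hstep : ∀ (k : ℕ) (a : ℝ), 0 ≤ a → (a + 1) ^ (k + 1) ≤ a ^ (k + 1) + (k + 1) * (a + 1) ^ k := by
    intro k a ha
    induction k with
    | zero => simp
    | succ k ih =>
      have h1 : 0 ≤ (k + 1 : ℝ) * (a + 1) ^ k := by positivity
      have h2 := mul_le_mul_of_nonneg_left ih ha
      push_cast
      rw [pow_succ (a + 1) (k + 1), pow_succ a (k + 1)]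
      have h3 : (a + 1) ^ (k + 1) = (a + 1) ^ k * (a + 1) := pow_succ _ _
      nlinarith
  induction n with
  | zero => simp
  | succ n ih =>
    rw [Finset.sum_range_succ]
    push_cast
    linarith [hstep k n n.cast_nonneg]

namespace CompoundTail

variable {d : ℝ} {p : ℕ → ℝ} {F : ℕ → ℝ → ℝ} {U V W H : ℝ → ℝ} {α : ℝ}

theorem d_nonneg (h : CompoundTail d p F U V W) : 0 ≤ d :=
  h.sum_mul_p.nonneg fun n => mul_nonneg n.cast_nonneg (h.p_nonneg n)

theorem hasSum_U (h : CompoundTail d p F U V W) {z : ℝ} (hz : 0 ≤ z) :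
    HasSum (fun n => p (n + (⌊z⌋₊ + 1))) (U z) := by
  rw [h.U_eq z hz]
  exact (hasSum_nat_add_iff' _).2 h.sum_p

theorem sum_Ioc_le_U (h : CompoundTail d p F U V W) {z : ℝ} (hz : 0 ≤ z) (N : ℕ) :
    ∑ n ∈ Finset.Ioc ⌊z⌋₊ N, p n ≤ U z := by
  have hd : Disjoint (Finset.range (⌊z⌋₊ + 1)) (Finset.Ioc ⌊z⌋₊ N) := by
    rw [Finset.disjoint_left]
    intro a ha hb
    rw [Finset.mem_range] at ha
    rw [Finset.mem_Ioc] at hb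
    omega
  have := sum_le_hasSum (Finset.range (⌊z⌋₊ + 1) ∪ Finset.Ioc ⌊z⌋₊ N)
    (fun n _ => h.p_nonneg n) h.sum_p
  rw [Finset.sum_union hd] at this
  rw [h.U_eq z hz]
  linarith

theorem W_le (h : CompoundTail d p F U V W) {b : ℝ} (hb : 0 ≤ b) (x : ℝ) :
    W x ≤ U b + ∑ n ∈ Finset.range (⌊b⌋₊ + 1), p n * F n x := by
  have h1 := (hasSum_nat_add_iff' (⌊b⌋₊ + 1)).2 (h.sum_W x)
  have h2 := hasSum_le (fun n => mul_le_of_le_one_right (h.p_nonneg (n + (⌊b⌋₊ + 1)))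
    (h.F_le_one _ x)) h1 (h.hasSum_U hb)
  linarith

theorem le_W (h : CompoundTail d p F U V W) {b x σ : ℝ} (hb : 0 ≤ b) {N : ℕ} (hN : (N : ℝ) ≤ b)
    (hF : ∀ n : ℕ, b < n → σ ≤ F n x) :
    ∑ n ∈ Finset.range N, p n * F n x + σ * U b ≤ W x := by
  have h1 := (hasSum_nat_add_iff' (⌊b⌋₊ + 1)).2 (h.sum_W x)
  have h2 := hasSum_le (fun n => ?_) ((h.hasSum_U hb).mul_left σ) h1
  · have h3 : ∑ n ∈ Finset.range N, p n * F n x ≤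
        ∑ n ∈ Finset.range (⌊b⌋₊ + 1), p n * F n x := by
      refine Finset.sum_le_sum_of_subset_of_nonneg (fun n hn => ?_)
        fun n _ _ => mul_nonneg (h.p_nonneg n) (h.F_nonneg n x)
      have := Nat.le_floor hN
      rw [Finset.mem_range] at hn ⊢
      omega
    linarith
  · rw [mul_comm]
    refine mul_le_mul_of_nonneg_left (hF _ ?_) (h.p_nonneg _)
    have := Nat.lt_floor_add_one b
    push_cast
    have : (0 : ℝ) ≤ n := n.cast_nonneg
    linarith

/-- Truncated moments of the number of summands. -/
theorem exists_sum_pow_le (h : CompoundTail d p F U V W) (hH : IsRVTail α H) {CU : ℝ}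
    (hU : ∀ x, 0 ≤ x → U x ≤ CU * H x) {k : ℕ} (hk : α < k) :
    ∃ C : ℝ, 0 < C ∧ ∀ z, 0 ≤ z → ∑ n ∈ Finset.range (⌊z⌋₊ + 1), p n * (n : ℝ) ^ (k + 1) ≤
      C * ((z + 1) ^ (k + 1) * H z) := by
  obtain ⟨C, hC, hpot⟩ := hH.exists_pow_mul_le hk
  have hCU : 0 ≤ CU := by
    have h1 := hU 0 le_rfl
    have h2 := sum_le_hasSum (Finset.range (⌊(0:ℝ)⌋₊ + 1)) (fun n _ => h.p_nonneg n) h.sum_p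
    rw [h.U_eq 0 le_rfl] at h1
    by_contra hc
    nlinarith [hH.pos 0]
  refine ⟨(k + 1) * CU * C + 1, by positivity, fun z hz => ?_⟩
  have hHz := (hH.pos z).le
  have h1 : ∑ n ∈ Finset.range (⌊z⌋₊ + 1), p n * (n : ℝ) ^ (k + 1) ≤
      ∑ n ∈ Finset.range (⌊z⌋₊ + 1), ∑ j ∈ Finset.range n, p n * ((k + 1) * ((j : ℝ) + 1) ^ k) := by
    refine Finset.sum_le_sum fun n _ => ?_
    rw [← Finset.mul_sum]
    exact mul_le_mul_of_nonneg_left (pow_succ_le_sum k n) (h.p_nonneg n)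
  -- Summation by parts: for fixed j the sum of `p n` over j < n ≤ z is at most U(j), and Potter's
  -- bound moves (j+1)^k H(j) up to level z. The number of j's supplies the last power of z.
  rw [Finset.sum_comm' (t' := Finset.range ⌊z⌋₊) (s' := fun j => Finset.Ioc j ⌊z⌋₊)
    (fun n j => by simp only [Finset.mem_range, Finset.mem_Ioc]; omega)] at h1
  refine h1.trans ?_
  have h2 : ∀ j ∈ Finset.range ⌊z⌋₊,
      ∑ n ∈ Finset.Ioc j ⌊z⌋₊, p n * ((k + 1) * ((j : ℝ) + 1) ^ k) ≤
      (k + 1) * CU * C * ((z + 1) ^ k * H z) := by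
    intro j hj
    rw [← Finset.sum_mul]
    have hjz : (j : ℝ) ≤ z := by
      rw [Finset.mem_range] at hj
      exact (Nat.cast_le.2 hj.le).trans (Nat.floor_le hz)
    have h3 := h.sum_Ioc_le_U (z := (j : ℝ)) j.cast_nonneg ⌊z⌋₊
    rw [Nat.floor_natCast] at h3
    have h4 := hpot j z j.cast_nonneg hjz
    calc (∑ n ∈ Finset.Ioc j ⌊z⌋₊, p n) * ((k + 1) * ((j : ℝ) + 1) ^ k)
        ≤ (CU * H j) * ((k + 1) * ((j : ℝ) + 1) ^ k) := by
          gcongr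
          exact h3.trans (hU j j.cast_nonneg)
      _ = (k + 1) * CU * (((j : ℝ) + 1) ^ k * H j) := by ring
      _ ≤ (k + 1) * CU * (C * ((z + 1) ^ k * H z)) := by gcongr
      _ = _ := by ring
  refine (Finset.sum_le_card_nsmul _ _ _ h2).trans ?_
  rw [Finset.card_range, nsmul_eq_mul]
  have h5 := Nat.floor_le hz
  have h6 : 0 ≤ (z + 1) ^ (k + 1) * H z := by positivity
  have h7 : 0 ≤ (k + 1) * CU * C * ((z + 1) ^ k * H z) := by positivity
  calc (⌊z⌋₊ : ℝ) * ((k + 1) * CU * C * ((z + 1) ^ k * H z))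
      ≤ (z + 1) * ((k + 1) * CU * C * ((z + 1) ^ k * H z)) := by gcongr; linarith
    _ = (k + 1) * CU * C * ((z + 1) ^ (k + 1) * H z) := by ring
    _ ≤ _ := by linarith

/-- The contribution of a number of summands which is small compared with the level. -/
theorem exists_sum_le (h : CompoundTail d p F U V W) (hH : IsRVTail α H) {CU : ℝ}
    (hU : ∀ x, 0 ≤ x → U x ≤ CU * H x) :
    ∃ q : ℕ, 0 < q ∧ ∃ K : ℝ, 0 < K ∧ ∀ η, 0 < η → η < 1 → ∀ δ, 0 < δ → ∀ᶠ x in atTop,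
      ∑ n ∈ Finset.range (⌊η * x⌋₊ + 1), p n * F n x ≤
        d * V ((1 - δ) * x) + d * (η / δ) * V (x / q) + K * η * H x := by
  obtain ⟨k, hk⟩ := exists_nat_gt α
  obtain ⟨C, hC, hmom⟩ := h.exists_sum_pow_le hH hU hk
  have he := Real.exp_pos 1
  -- One factor 2 comes from η x + 1 ≤ 2 η x, the other from H(η x) ≤ 2 η^(-α) H(x).
  refine ⟨k + 1, k.succ_pos, C * (2 * Real.exp 1) ^ (k + 1) * 2, by positivity, ?_⟩
  intro η hη hη1 δ hδ
  filter_upwards [hH.eventually_le hη, eventually_ge_atTop (1 / η)] with x hx hx1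
  have hx0 : 0 < x := lt_of_lt_of_le (by positivity) hx1
  rw [div_le_iff₀ hη] at hx1
  have hηx : 0 < η * x := by positivity
  have hsum : ∑ n ∈ Finset.range (⌊η * x⌋₊ + 1), (n : ℝ) * p n ≤ d :=
    sum_le_hasSum _ (fun n _ => mul_nonneg n.cast_nonneg (h.p_nonneg n)) h.sum_mul_p
  have hV1 := h.V_nonneg ((1 - δ) * x)
  have hV2 := h.V_nonneg (x / (k + 1 : ℕ))
  calc ∑ n ∈ Finset.range (⌊η * x⌋₊ + 1), p n * F n x
      ≤ ∑ n ∈ Finset.range (⌊η * x⌋₊ + 1), ((n * p n) * (V ((1 - δ) * x)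
          + η / δ * V (x / (k + 1 : ℕ))) + (Real.exp 1 / x) ^ (k + 1) * (p n * n ^ (k + 1))) := by
        refine Finset.sum_le_sum fun n hn => ?_
        have hn' : (n : ℝ) ≤ η * x :=
          (Nat.cast_le.2 (Nat.lt_succ_iff.1 (Finset.mem_range.1 hn))).trans (Nat.floor_le hηx.le)
        have hnx : (n : ℝ) ≤ x := hn'.trans (mul_le_of_le_one_left hx0.le hη1.le)
        have h1 := h.F_le n x δ (k + 1) hx0 hδ k.succ_pos hnx
        have h2 : (n : ℝ) / (δ * x) ≤ η / δ := by
          rw [div_le_div_iff₀ (by positivity) hδ]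
          nlinarith
        have h3 : n * V (x / (k + 1 : ℕ)) * (n / (δ * x)) ≤ n * V (x / (k + 1 : ℕ)) * (η / δ) := by
          gcongr
        have h4 : (Real.exp 1 * n / x) ^ (k + 1) =
            (Real.exp 1 / x) ^ (k + 1) * (n : ℝ) ^ (k + 1) := by
          rw [← mul_pow]; ring
        have h5 := mul_le_mul_of_nonneg_left (h1.trans (by gcongr)) (h.p_nonneg n)
          (c := n * V ((1 - δ) * x) + n * V (x / (k + 1 : ℕ)) * (η / δ) +
            (Real.exp 1 * n / x) ^ (k + 1))
        rw [h4] at h5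
        linarith
    _ = (∑ n ∈ Finset.range (⌊η * x⌋₊ + 1), (n : ℝ) * p n) * (V ((1 - δ) * x)
          + η / δ * V (x / (k + 1 : ℕ))) + (Real.exp 1 / x) ^ (k + 1) *
          ∑ n ∈ Finset.range (⌊η * x⌋₊ + 1), (p n * n ^ (k + 1)) := by
        rw [Finset.sum_add_distrib, Finset.sum_mul, Finset.mul_sum]
    _ ≤ d * (V ((1 - δ) * x) + η / δ * V (x / (k + 1 : ℕ))) + (Real.exp 1 / x) ^ (k + 1) *
          (C * ((2 * (η * x)) ^ (k + 1) * (2 * η ^ (-α) * H x))) := by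
        gcongr
        refine (hmom (η * x) hηx.le).trans ?_
        have := (hH.pos (η * x)).le
        gcongr
        linarith
    _ = d * V ((1 - δ) * x) + d * (η / δ) * V (x / (k + 1 : ℕ)) +
          C * (2 * Real.exp 1) ^ (k + 1) * 2 * (η ^ (k + 1) * η ^ (-α)) * H x := by
        have : (Real.exp 1 / x) ^ (k + 1) * (2 * (η * x)) ^ (k + 1) =
            (2 * Real.exp 1) ^ (k + 1) * η ^ (k + 1) := by
          rw [← mul_pow, ← mul_pow]
          congr 1
          field_simp
        linear_combination (C * (2 * η ^ (-α) * H x)) * this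
    _ ≤ _ := by
        have hHx := (hH.pos x).le
        -- Here k > α makes the exponent k + 1 - α at least 1; this is why q = k + 1 was taken.
        have : η ^ (k + 1) * η ^ (-α) ≤ η := by
          rw [← Real.rpow_natCast, ← Real.rpow_add hη]
          calc η ^ (((k + 1 : ℕ) : ℝ) + -α) ≤ η ^ (1 : ℝ) := by
                apply Real.rpow_le_rpow_of_exponent_ge hη hη1.le
                push_cast
                linarith
            _ = η := Real.rpow_one η
        gcongr

/-- The number n of summands is split at ηx and (1-ε)x. Above, `F n x` ≤ 1 gives U; below,
`exists_sum_le` gives d V; in between the law of large numbers makes `F n x` small, while the mass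
there is at most U(ηx) = O(H(x)). -/
theorem W_eventually_le (h : CompoundTail d p F U V W) (hH : IsRVTail α H) {CU CV : ℝ}
    (hU : ∀ x, 0 ≤ x → U x ≤ CU * H x) (hV : ∀ x, 0 ≤ x → V x ≤ CV * H x)
    {ε τ : ℝ} (hε : 0 < ε) (hε1 : ε < 1) (hτ : 0 < τ) :
    ∀ᶠ x in atTop, W x ≤ U ((1 - ε) * x) + d * V ((1 - ε) * x) + τ * H x := by
  obtain ⟨q, hq, K, hK, hsmall⟩ := h.exists_sum_le hH hU
  have hd := h.d_nonneg
  have hCV : 0 ≤ CV := by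
    by_contra hc
    nlinarith [hV 0 le_rfl, h.V_nonneg 0, hH.pos 0]
  have hq' : (0 : ℝ) < q := Nat.cast_pos.2 hq
  -- `B * η` bounds the η-dependent errors of `exists_sum_le`; η takes half of τ, and σ, chosen
  -- after η, takes the other half.
  set B := d / ε * (CV * (2 * (1 / q : ℝ) ^ (-α))) + K with hB
  have hB0 : 0 < B := by positivity
  obtain ⟨η, hη0, hη⟩ : ∃ η, 0 < η ∧ η < min (1 - ε) (τ / (2 * B)) :=
    exists_between (lt_min (by linarith) (by positivity))
  have hη1 : η < 1 - ε := hη.trans_le (min_le_left _ _)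
  have hη2 : B * η ≤ τ / 2 := by
    have := (hη.trans_le (min_le_right _ _)).le
    rw [le_div_iff₀ (by positivity)] at this
    linarith
  have hηα := Real.rpow_pos_of_pos hη0 (-α)
  set σ := τ / 2 / (|CU| * (2 * η ^ (-α)) + 1) with hσ
  have hσ0 : 0 < σ := by positivity
  have hlln := (h.F_above (1 + ε) (by linarith)).eventually (gt_mem_nhds hσ0)
  obtain ⟨N, hN⟩ := hlln.exists_forall_of_atTop
  filter_upwards [hsmall η hη0 (by linarith) ε hε, hH.eventually_le hη0,
    hH.eventually_le (t := 1 / q) (by positivity), eventually_ge_atTop (N / η),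
    eventually_gt_atTop 0] with x h1 h2 h3 h4 hx0
  have hHx := (hH.pos x).le
  rw [div_le_iff₀ hη0] at h4
  have hb : 0 ≤ (1 - ε) * x := mul_nonneg (by linarith) hx0.le
  have hηx : 0 ≤ η * x := by positivity
  have hle : ⌊η * x⌋₊ ≤ ⌊(1 - ε) * x⌋₊ := Nat.floor_le_floor (by gcongr)
  have hsplit : ∑ n ∈ Finset.range (⌊(1 - ε) * x⌋₊ + 1), p n * F n x =
      ∑ n ∈ Finset.range (⌊η * x⌋₊ + 1), p n * F n x +
        ∑ n ∈ Finset.Ioc ⌊η * x⌋₊ ⌊(1 - ε) * x⌋₊, p n * F n x := by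
    rw [← Finset.sum_range_add_sum_Ico _ (Nat.succ_le_succ hle)]
    congr 1
    refine Finset.sum_congr ?_ fun _ _ => rfl
    ext a
    simp only [Finset.mem_Ico, Finset.mem_Ioc]
    omega
  have hmid : ∑ n ∈ Finset.Ioc ⌊η * x⌋₊ ⌊(1 - ε) * x⌋₊, p n * F n x ≤ σ * U (η * x) := by
    calc ∑ n ∈ Finset.Ioc ⌊η * x⌋₊ ⌊(1 - ε) * x⌋₊, p n * F n x
        ≤ ∑ n ∈ Finset.Ioc ⌊η * x⌋₊ ⌊(1 - ε) * x⌋₊, σ * p n := by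
          refine Finset.sum_le_sum fun n hn => ?_
          rw [Finset.mem_Ioc] at hn
          rw [mul_comm σ]
          refine mul_le_mul_of_nonneg_left ?_ (h.p_nonneg n)
          have hn1 : η * x < n := (Nat.floor_lt hηx).1 hn.1
          have hn2 : (n : ℝ) ≤ (1 - ε) * x := (Nat.cast_le.2 hn.2).trans (Nat.floor_le hb)
          refine le_trans (h.F_anti n ?_) (hN n ?_).le
          -- (1+ε)n ≤ (1-ε²)x ≤ x, so the law of large numbers above the mean applies.
          · have := mul_le_mul_of_nonneg_left hn2 (by linarith : 0 ≤ 1 + ε)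
            have := mul_nonneg (sq_nonneg ε) hx0.le
            nlinarith
          · exact_mod_cast (by linarith : (N : ℝ) ≤ n)
      _ = σ * ∑ n ∈ Finset.Ioc ⌊η * x⌋₊ ⌊(1 - ε) * x⌋₊, p n := by rw [Finset.mul_sum]
      _ ≤ σ * U (η * x) := by
          gcongr
          exact h.sum_Ioc_le_U hηx _
  have hmid2 : σ * U (η * x) ≤ τ / 2 * H x := by
    calc σ * U (η * x) ≤ σ * (|CU| * (2 * η ^ (-α) * H x)) := by
          gcongr
          refine (hU _ hηx).trans ?_
          have := (hH.pos (η * x)).le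
          gcongr
          exact le_abs_self _
      _ = σ * (|CU| * (2 * η ^ (-α)) * H x) := by ring
      _ ≤ σ * ((|CU| * (2 * η ^ (-α)) + 1) * H x) := by gcongr; linarith
      _ = τ / 2 * H x := by rw [hσ]; field_simp
  have hVq : V (x / q) ≤ CV * (2 * (1 / q : ℝ) ^ (-α) * H x) := by
    refine (hV _ (by positivity)).trans ?_
    rw [show x / q = 1 / q * x by ring]
    gcongr
  have hlast : d * (η / ε) * V (x / q) + K * η * H x ≤ τ / 2 * H x := by
    calc d * (η / ε) * V (x / q) + K * η * H x
        ≤ d * (η / ε) * (CV * (2 * (1 / q : ℝ) ^ (-α) * H x)) + K * η * H x := by gcongr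
      _ = B * η * H x := by rw [hB]; ring
      _ ≤ τ / 2 * H x := by gcongr
  have := h.W_le hb x
  linarith

/-- Values n > (1+ε)x contribute U by the law of large numbers; finitely many small n already carry
mean d - τ/2 and contribute V through `le_F`, whose quadratic loss is negligible because V(x) ≤ 1/x.
No regular variation is needed. -/
theorem eventually_le_W (h : CompoundTail d p F U V W) {ε τ : ℝ} (hε : 0 < ε) (hτ : 0 < τ) :
    ∀ᶠ x in atTop, (1 - τ) * U ((1 + ε) * x) + (d - τ) * V x ≤ W x := by
  obtain ⟨N, hN⟩ := (h.sum_mul_p.tendsto_sum_nat.eventually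
    (lt_mem_nhds (by linarith : d - τ / 2 < d))).exists
  set A := ∑ n ∈ Finset.range N, p n * (n : ℝ) ^ 2 with hA
  have hA0 : 0 ≤ A := Finset.sum_nonneg fun n _ => mul_nonneg (h.p_nonneg n) (by positivity)
  have hlln := (h.F_below (1 / (1 + ε)) (by rw [div_lt_one (by linarith)]; linarith)).eventually
    (lt_mem_nhds (by linarith : 1 - τ < 1))
  obtain ⟨N', hN'⟩ := hlln.exists_forall_of_atTop
  filter_upwards [eventually_gt_atTop 0, eventually_ge_atTop (N : ℝ), eventually_ge_atTop (N' : ℝ),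
    eventually_ge_atTop (2 * A / τ)] with x hx0 hxN hxN' hxA
  have hbx : x ≤ (1 + ε) * x := by nlinarith
  have h1 := h.le_W (b := (1 + ε) * x) (x := x) (σ := 1 - τ) (by positivity) (hxN.trans hbx)
    (fun n hn => by
      refine (hN' n ?_).le.trans (h.F_anti n ?_)
      · exact_mod_cast (by linarith : (N' : ℝ) ≤ n)
      · rw [one_div, inv_mul_eq_div, le_div_iff₀ (by linarith)]
        linarith)
  have hVx := h.V_nonneg x
  have h2 : V x * ∑ n ∈ Finset.range N, (n : ℝ) * p n - V x ^ 2 * A ≤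
      ∑ n ∈ Finset.range N, p n * F n x := by
    rw [hA, Finset.mul_sum, Finset.mul_sum, ← Finset.sum_sub_distrib]
    refine Finset.sum_le_sum fun n _ => ?_
    have := mul_le_mul_of_nonneg_left (h.le_F n x hx0.le) (h.p_nonneg n)
    linarith
  have h3 : V x * A ≤ τ / 2 := by
    calc V x * A ≤ 1 / x * A := by gcongr; exact h.V_le_inv x hx0
      _ ≤ τ / 2 := by
        rw [div_le_iff₀ hτ] at hxA
        rw [one_div, inv_mul_eq_div, div_le_iff₀ hx0]
        linarith
  nlinarith

end CompoundTail

/-! ### Solving the functional equation asymptotically. -/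

theorem tendsto_affine_div (a b : ℝ) :
    Tendsto (fun y : ℝ => (a * y + b) / y) atTop (𝓝 a) := by
  have h : Tendsto (fun y : ℝ => a + b * y⁻¹) atTop (𝓝 (a + b * 0)) :=
    tendsto_const_nhds.add (tendsto_inv_atTop_zero.const_mul b)
  rw [mul_zero, add_zero] at h
  refine h.congr' ?_
  filter_upwards [eventually_gt_atTop 0] with y hy
  field_simp

namespace IsRVTail

variable {α : ℝ} {H : ℝ → ℝ}

theorem tendsto_affine (hH : IsRVTail α H) {a : ℝ} (ha : 0 < a) (b : ℝ) :
    Tendsto (fun y => H (a * y + b) / H y) atTop (𝓝 (a ^ (-α))) :=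
  hH.tendsto_comp_div ha (tendsto_affine_div a b)

theorem exists_le (hH : IsRVTail α H) {G : ℝ → ℝ} (hG : ∀ x, G x ≤ 1) {C : ℝ}
    (h : ∀ᶠ x in atTop, G x ≤ C * H x) : ∃ C', ∀ x, G x ≤ C' * H x := by
  obtain ⟨x₀, hx₀⟩ := h.exists_forall_of_atTop
  refine ⟨max C (1 / H x₀), fun x => ?_⟩
  have hHx := hH.pos x
  have hH0 := hH.pos x₀
  rcases le_total x₀ x with hx | hx
  · exact (hx₀ x hx).trans (by gcongr; exact le_max_left _ _)
  · calc G x ≤ 1 := hG x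
      _ = 1 / H x₀ * H x₀ := by field_simp
      _ ≤ 1 / H x₀ * H x := by gcongr; exact hH.anti hx
      _ ≤ _ := by gcongr; exact le_max_right _ _

end IsRVTail

/-- Used to pick ε so small that a limit constant depending on ε still satisfies the strict
inequality valid at ε = 0. -/
theorem exists_pos_lt_one_of_continuousAt {φ : ℝ → ℝ} (hφ : ContinuousAt φ 0) {s : Set ℝ}
    (hs : s ∈ 𝓝 (φ 0)) : ∃ ε, 0 < ε ∧ ε < 1 ∧ φ ε ∈ s := by
  have h1 : ∀ᶠ ε in 𝓝[>] (0 : ℝ), φ ε ∈ s := (hφ.eventually_mem hs).filter_mono nhdsWithin_le_nhds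
  have h2 : ∀ᶠ ε in 𝓝[>] (0 : ℝ), ε < 1 := (gt_mem_nhds one_pos).filter_mono nhdsWithin_le_nhds
  obtain ⟨ε, ⟨h1, h2⟩, h3⟩ := ((h1.and h2).and self_mem_nhdsWithin).exists
  exact ⟨ε, h3, h2, h1⟩

namespace CompoundTail

variable {d : ℝ} {p : ℕ → ℝ} {F : ℕ → ℝ → ℝ} {U V W : ℝ → ℝ} {α c : ℝ}

theorem tendsto_U_div_V (h : CompoundTail d p F U V W) (hV : IsRVTail α V) (hc0 : 0 < c)
    (hc1 : c < 1) (hd : 1 ≤ d) (heq : ∀ x, V (c / d * x + (1 - c)) = W x) :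
    Tendsto (fun x => U x / V x) atTop (𝓝 ((c / d) ^ (-α) - d)) := by
  have hcd : 0 < c / d := by positivity
  have hU1 : ∀ x, 0 ≤ x → U x ≤ 1 := fun x hx => by
    rw [h.U_eq x hx]
    linarith [Finset.sum_nonneg fun n (_ : n ∈ Finset.range (⌊x⌋₊ + 1)) => h.p_nonneg n]
  -- The a priori bound U = O(V) comes from the lower estimate at x/2 with ε = 1, which puts U at
  -- exactly x. The `max` restricts to nonnegative arguments, where `U_eq` controls U.
  obtain ⟨CU, hCU⟩ : ∃ C, ∀ x, 0 ≤ x → U x ≤ C * V x := by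
    have h2 : Tendsto (fun x : ℝ => 1 / 2 * x) atTop atTop :=
      tendsto_id.const_mul_atTop (by norm_num)
    have h1 := h2.eventually
      (h.eventually_le_W (ε := 1) (τ := 1 / 2) one_pos (by norm_num))
    have h3 := hV.eventually_le (t := c / d * (1 / 2)) (by positivity)
    obtain ⟨C, hC⟩ := hV.exists_le (G := fun x => U (max x 0))
      (fun x => hU1 _ (le_max_right _ _)) (C := 2 * (2 * (c / d * (1 / 2)) ^ (-α))) (by
        filter_upwards [h1, h3, eventually_ge_atTop 0] with x h1 h3 hx
        rw [max_eq_left hx]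
        rw [show (1 + 1) * (1 / 2 * x) = x by ring, ← heq] at h1
        have h4 : V (c / d * (1 / 2 * x) + (1 - c)) ≤ V (c / d * (1 / 2) * x) :=
          hV.anti (by linarith)
        have h5 : 0 ≤ (d - 1 / 2) * V (1 / 2 * x) :=
          mul_nonneg (by linarith) (h.V_nonneg _)
        linarith)
    exact ⟨C, fun x hx => by simpa [max_eq_left hx] using hC x⟩
  have hone : ∀ x, 0 ≤ x → V x ≤ 1 * V x := fun x _ => (one_mul _).ge
  rw [tendsto_order]
  constructor
  · intro a ha
    obtain ⟨ε, hε0, hε1, hε⟩ := exists_pos_lt_one_of_continuousAt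
      (φ := fun ε => (c / d * (1 - ε)⁻¹) ^ (-α) - d - ε * ((1 - ε)⁻¹) ^ (-α)) (s := Set.Ioi a) (by
        have h1 : ContinuousAt (fun ε : ℝ => (1 - ε)⁻¹) 0 :=
          ContinuousAt.inv₀ (by fun_prop) (by norm_num)
        refine ContinuousAt.sub (ContinuousAt.sub (ContinuousAt.rpow_const (by fun_prop)
          (Or.inl (by simp [hcd.ne']))) continuousAt_const) (ContinuousAt.mul continuousAt_id
          (ContinuousAt.rpow_const h1 (Or.inl (by norm_num)))))
      (lt_mem_nhds (by simpa using ha))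
    have hε' : 0 < 1 - ε := by linarith
    have hs : 0 < (1 - ε)⁻¹ := inv_pos.2 hε'
    -- The estimate is read at x = y/(1-ε), so that U is evaluated at y.
    have h1 := (tendsto_id.const_mul_atTop hs).eventually
      (h.W_eventually_le hV hCU hone hε0 hε1 hε0)
    have h2 := ((hV.tendsto_affine (a := c / d * (1 - ε)⁻¹) (by positivity) (1 - c)).sub_const
      d).sub ((hV.ratio _ hs).const_mul ε)
    filter_upwards [h1, h2.eventually (lt_mem_nhds hε)] with y h1 h2
    refine h2.trans_le ?_
    have hVy := hV.pos y
    simp only [id] at h1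
    rw [← mul_assoc, mul_inv_cancel₀ hε'.ne', one_mul, ← heq, ← mul_assoc] at h1
    rw [le_div_iff₀ hVy, sub_mul, sub_mul, mul_assoc ε, div_mul_cancel₀ _ hVy.ne',
      div_mul_cancel₀ _ hVy.ne']
    linarith
  · intro a ha
    obtain ⟨ε, hε0, hε1, hε⟩ := exists_pos_lt_one_of_continuousAt
      (φ := fun ε => ((c / d * (1 + ε)⁻¹) ^ (-α) - (d - ε) * ((1 + ε)⁻¹) ^ (-α)) / (1 - ε))
      (s := Set.Iio a) (by
        have h1 : ContinuousAt (fun ε : ℝ => (1 + ε)⁻¹) 0 :=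
          ContinuousAt.inv₀ (by fun_prop) (by norm_num)
        refine ContinuousAt.div (ContinuousAt.sub (ContinuousAt.rpow_const (by fun_prop)
          (Or.inl (by simp [hcd.ne']))) (ContinuousAt.mul (by fun_prop)
          (ContinuousAt.rpow_const h1 (Or.inl (by norm_num))))) (by fun_prop) (by norm_num))
      (gt_mem_nhds (by simpa using ha))
    have hε' : 0 < 1 + ε := by linarith
    have hs : 0 < (1 + ε)⁻¹ := inv_pos.2 hε'
    have h1 := (tendsto_id.const_mul_atTop hs).eventually (h.eventually_le_W hε0 hε0)
    have h2 := ((hV.tendsto_affine (a := c / d * (1 + ε)⁻¹) (by positivity) (1 - c)).sub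
      ((hV.ratio _ hs).const_mul (d - ε))).div_const (1 - ε)
    filter_upwards [h1, h2.eventually (gt_mem_nhds hε)] with y h1 h2
    refine lt_of_le_of_lt ?_ h2
    have hVy := hV.pos y
    simp only [id] at h1
    rw [← mul_assoc, mul_inv_cancel₀ hε'.ne', one_mul, ← heq, ← mul_assoc] at h1
    rw [le_div_iff₀ (by linarith), div_mul_eq_mul_div, div_le_iff₀ hVy, sub_mul, mul_assoc (d - ε),
      div_mul_cancel₀ _ hVy.ne', div_mul_cancel₀ _ hVy.ne']
    linarith

/-- The recursion bounds V(y) by C₁U(y) plus a positive linear operator applied to V. That operator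
shrinks both U and 1/y by a factor ρ < 1, so V ≤ 1/y improves to V ≤ G U + ρ^n / y for every n. -/
theorem exists_V_le (h : CompoundTail d p F U V W) (hU : IsRVTail α U) (hα : 1 < α) (hc0 : 0 < c)
    (hc1 : c < 1) (hd : 1 ≤ d) (heq : ∀ x, V (c / d * x + (1 - c)) = W x) :
    ∃ C, ∀ x, V x ≤ C * U x := by
  have hd0 : 0 < d := by linarith
  have hdc : 0 < d / c := by positivity
  obtain ⟨q, hq, K, hK, hsmall⟩ := h.exists_sum_le hU (CU := 1) fun x _ => (one_mul _).ge
  have hq' : (0 : ℝ) < q := Nat.cast_pos.2 hq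
  obtain ⟨ρ, hρc, hρ1⟩ := exists_between hc1
  have hρ0 : 0 < ρ := hc0.trans hρc
  have hdα : d * (d / c) ^ (-α) < ρ := by
    refine lt_of_le_of_lt ?_ hρc
    have h1 : (d / c) ^ (-α) ≤ (d / c) ^ (-1 : ℝ) := by
      refine Real.rpow_le_rpow_of_exponent_le ?_ (by linarith)
      rw [le_div_iff₀ hc0]
      linarith
    rw [Real.rpow_neg_one] at h1
    calc d * (d / c) ^ (-α) ≤ d * (d / c)⁻¹ := by gcongr
      _ = c := by field_simp
  -- The two entries of the maximum are the contraction factors on U and on 1/y; at δ = 0 they are d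
  -- (d/c)^(-α) and c. The same pattern then fixes η.
  obtain ⟨δ, hδ0, hδ1, hδ⟩ := exists_pos_lt_one_of_continuousAt
    (φ := fun δ => max (d * ((1 - δ) * (d / c)) ^ (-α)) (c * (1 - δ)⁻¹)) (s := Set.Iio ρ) (by
      refine Filter.Tendsto.max (ContinuousAt.mul continuousAt_const
        (ContinuousAt.rpow_const (by fun_prop) (Or.inl (by simp [hdc.ne']))))
        (ContinuousAt.mul continuousAt_const (ContinuousAt.inv₀ (by fun_prop) (by norm_num))))
    (gt_mem_nhds (by simpa using ⟨hdα, hρc⟩))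
  rw [Set.mem_Iio, max_lt_iff] at hδ
  obtain ⟨η, hη0, hη1, hη⟩ := exists_pos_lt_one_of_continuousAt
    (φ := fun η => max
      (d * ((1 - δ) * (d / c)) ^ (-α) + d * (η / δ) * (1 / q * (d / c)) ^ (-α))
      (c * (1 - δ)⁻¹ + c * (η / δ) * q)) (s := Set.Iio ρ) (by
      refine Filter.Tendsto.max (ContinuousAt.tendsto (by fun_prop))
        (ContinuousAt.tendsto (by fun_prop)))
    (gt_mem_nhds (by simpa using hδ))
  rw [Set.mem_Iio, max_lt_iff] at hη
  have hδ' : 0 < 1 - δ := by linarith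
  -- Inverse of the affine map in the equation: V(y) = W(X y).
  set X : ℝ → ℝ := fun y => d / c * y + -(d / c * (1 - c)) with hX
  have hXtop : Tendsto X atTop atTop :=
    tendsto_atTop_add_const_right _ _ (tendsto_id.const_mul_atTop hdc)
  have hXeq : ∀ y, c / d * X y + (1 - c) = y := fun y => by simp only [hX]; field_simp; ring
  have hXs : ∀ s, 0 < s → Tendsto (fun y => U (s * X y) / U y) atTop (𝓝 ((s * (d / c)) ^ (-α))) := by
    intro s hs
    refine (hU.tendsto_affine (a := s * (d / c)) (by positivity)
      (-(s * (d / c) * (1 - c)))).congr fun y => ?_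
    congr 2
    simp only [hX]
    ring
  have hXinv : Tendsto (fun y => y / X y) atTop (𝓝 (c / d)) := by
    have := (tendsto_affine_div (d / c) (-(d / c * (1 - c)))).inv₀ hdc.ne'
    simpa only [inv_div] using this
  set C₁ := 2 * (η * (d / c)) ^ (-α) + K * η * (2 * (1 * (d / c)) ^ (-α)) with hC₁
  have hpos1 : 0 < (η * (d / c)) ^ (-α) := Real.rpow_pos_of_pos (by positivity) _
  have hpos2 : 0 < (1 * (d / c)) ^ (-α) := Real.rpow_pos_of_pos (by positivity) _
  have hC₁0 : 0 < C₁ := by positivity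
  have hev : ∀ᶠ y in atTop, 0 < y ∧ 0 < X y ∧
      V y ≤ C₁ * U y + d * V ((1 - δ) * X y) + d * (η / δ) * V (X y / q) ∧
      d * U ((1 - δ) * X y) + d * (η / δ) * U (X y / q) ≤ ρ * U y ∧
      d * (1 / ((1 - δ) * X y)) + d * (η / δ) * (1 / (X y / q)) ≤ ρ * (1 / y) := by
    have hb := ((hXs (1 - δ) hδ').const_mul d).add
      ((hXs (1 / q) (by positivity)).const_mul (d * (η / δ)))
    have hc := hXinv.const_mul ((d / (1 - δ)) + d * (η / δ) * q)
    have hc' : ((d / (1 - δ)) + d * (η / δ) * q) * (c / d) < ρ := by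
      refine lt_of_eq_of_lt ?_ hη.2
      field_simp
    filter_upwards [hXtop.eventually (hsmall η hη0 hη1 δ hδ0), hXtop.eventually_gt_atTop 0,
      eventually_gt_atTop 0, hb.eventually (gt_mem_nhds hη.1), hc.eventually (gt_mem_nhds hc'),
      (hXs η hη0).eventually (gt_mem_nhds (by linarith : _ < 2 * (η * (d / c)) ^ (-α))),
      (hXs 1 one_pos).eventually (gt_mem_nhds (by linarith : _ < 2 * (1 * (d / c)) ^ (-α)))]
      with y h1 h2 h3 h4 h5 h6 h7
    have hUy := hU.pos y
    refine ⟨h3, h2, ?_, ?_, ?_⟩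
    · rw [div_lt_iff₀ hUy] at h6 h7
      rw [one_mul] at h7
      have h8 := h.W_le (b := η * X y) (by positivity) (X y)
      rw [← heq, hXeq] at h8
      have h9 : K * η * U (X y) ≤ K * η * (2 * (1 * (d / c)) ^ (-α) * U y) := by gcongr
      rw [hC₁]
      linarith
    · rw [mul_div_assoc', mul_div_assoc', ← add_div, div_lt_iff₀ hUy,
        one_div_mul_eq_div] at h4
      exact h4.le
    · calc d * (1 / ((1 - δ) * X y)) + d * (η / δ) * (1 / (X y / q))
          = ((d / (1 - δ)) + d * (η / δ) * q) * (y / X y) * (1 / y) := by field_simp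
        _ ≤ ρ * (1 / y) := by gcongr
  obtain ⟨y₀, hy₀⟩ := hev.exists_forall_of_atTop
  -- The first entry makes C₁ + Gρ ≤ G, closing the induction; the second covers y ≤ `y₀`, where the
  -- recursion is not available.
  set G := max (C₁ / (1 - ρ)) (1 / U y₀) with hG
  have hU0 := hU.pos y₀
  have hρ' : 0 < 1 - ρ := by linarith
  have hG0 : 0 < G := lt_max_of_lt_right (by positivity)
  have hGC : C₁ + G * ρ ≤ G := by
    have : C₁ ≤ G * (1 - ρ) := (div_le_iff₀ hρ').1 (le_max_left _ _)
    linarith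
  have hind : ∀ n : ℕ, ∀ y, 0 < y → V y ≤ G * U y + ρ ^ n * (1 / y) := by
    intro n
    induction n with
    | zero =>
      intro y hy
      have := h.V_le_inv y hy
      have := mul_pos hG0 (hU.pos y)
      simp only [pow_zero, one_mul]
      linarith
    | succ n ih =>
      intro y hy
      have hUy := hU.pos y
      rcases le_total y₀ y with hyy | hyy
      · obtain ⟨-, hX0, h1, h2, h3⟩ := hy₀ y hyy
        have h4 := ih ((1 - δ) * X y) (by positivity)
        have h5 := ih (X y / q) (by positivity)
        calc V y ≤ C₁ * U y + d * V ((1 - δ) * X y) + d * (η / δ) * V (X y / q) := h1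
          _ ≤ C₁ * U y + d * (G * U ((1 - δ) * X y) + ρ ^ n * (1 / ((1 - δ) * X y))) +
              d * (η / δ) * (G * U (X y / q) + ρ ^ n * (1 / (X y / q))) := by gcongr
          _ = C₁ * U y + G * (d * U ((1 - δ) * X y) + d * (η / δ) * U (X y / q)) +
              ρ ^ n * (d * (1 / ((1 - δ) * X y)) + d * (η / δ) * (1 / (X y / q))) := by ring
          _ ≤ C₁ * U y + G * (ρ * U y) + ρ ^ n * (ρ * (1 / y)) := by gcongr
          _ = (C₁ + G * ρ) * U y + ρ ^ (n + 1) * (1 / y) := by ring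
          _ ≤ G * U y + ρ ^ (n + 1) * (1 / y) := by gcongr
      · calc V y ≤ 1 := h.V_le_one y
          _ = 1 / U y₀ * U y₀ := by field_simp
          _ ≤ G * U y := by
            gcongr
            · exact le_max_right _ _
            · exact hU.anti hyy
          _ ≤ _ := le_add_of_nonneg_right (by positivity)
  refine hU.exists_le h.V_le_one (C := G) ?_
  filter_upwards [eventually_gt_atTop 0] with y hy
  have h1 : Tendsto (fun n : ℕ => G * U y + ρ ^ n * (1 / y)) atTop (𝓝 (G * U y + 0 * (1 / y))) :=
    tendsto_const_nhds.add ((tendsto_pow_atTop_nhds_zero_of_lt_one hρ0.le hρ1).mul_const _)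
  rw [zero_mul, add_zero] at h1
  exact ge_of_tendsto' h1 fun n => hind n y hy

theorem tendsto_V_div_U (h : CompoundTail d p F U V W) (hU : IsRVTail α U) (hα : 1 < α)
    (hc0 : 0 < c) (hc1 : c < 1) (hd : 1 ≤ d) (heq : ∀ x, V (c / d * x + (1 - c)) = W x) :
    Tendsto (fun x => V x / U x) atTop (𝓝 (1 / ((d / c) ^ α - d))) := by
  have hd0 : 0 < d := by linarith
  have hdc : 0 < d / c := by positivity
  obtain ⟨C, hC⟩ := h.exists_V_le hU hα hc0 hc1 hd heq
  set R := (d / c) ^ (-α) with hR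
  have hR0 : 0 < R := Real.rpow_pos_of_pos hdc _
  have hRα : (d / c) ^ α = 1 / R := by rw [hR, Real.rpow_neg hdc.le, one_div, inv_inv]
  set ρ := d * R with hρ
  have hρ0 : 0 < ρ := by positivity
  have hρ1 : ρ < 1 := by
    have h1 : R < (d / c) ^ (-1 : ℝ) := by
      refine Real.rpow_lt_rpow_of_exponent_lt ?_ (by linarith)
      rw [lt_div_iff₀ hc0]
      linarith
    rw [Real.rpow_neg_one] at h1
    calc ρ < d * (d / c)⁻¹ := by rw [hρ]; gcongr
      _ = c := by field_simp
      _ < 1 := hc1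
  set g := 1 / ((d / c) ^ α - d) with hg
  have hg' : g = R / (1 - ρ) := by
    rw [hg, hRα, hρ]
    field_simp
  have hρ' : 0 < 1 - ρ := by linarith
  have hg0 : 0 < g := by rw [hg']; positivity
  -- `g` is the fixed point of the limiting recursion for V/U, whose slope is ρ = d R.
  have hfix : (1 + d * g) * R = g := by
    rw [hg', hρ] at *
    field_simp
    ring
  set X : ℝ → ℝ := fun y => d / c * y + -(d / c * (1 - c)) with hX
  have hXtop : Tendsto X atTop atTop :=
    tendsto_atTop_add_const_right _ _ (tendsto_id.const_mul_atTop hdc)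
  have hXeq : ∀ y, c / d * X y + (1 - c) = y := fun y => by simp only [hX]; field_simp; ring
  have hXs : ∀ s, 0 < s → Tendsto (fun y => U (s * X y) / U y) atTop (𝓝 ((s * (d / c)) ^ (-α))) := by
    intro s hs
    refine (hU.tendsto_affine (a := s * (d / c)) (by positivity)
      (-(s * (d / c) * (1 - c)))).congr fun y => ?_
    congr 2
    simp only [hX]
    ring
  have hX1 : Tendsto (fun y => U (X y) / U y) atTop (𝓝 R) := by
    simpa only [one_mul] using hXs 1 one_pos
  -- One application of the equation multiplies the asymptotic error by ρ, up to an arbitrarily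
  -- small τ.
  have hstep : ∀ B τ, 0 ≤ B → 0 < τ → (∀ᶠ y in atTop, |V y - g * U y| ≤ B * U y) →
      ∀ᶠ y in atTop, |V y - g * U y| ≤ (ρ * B + τ) * U y := by
    intro B τ hB hτ hbd
    have hup : ∀ᶠ y in atTop, V y ≤ (g + ρ * B + τ) * U y := by
      obtain ⟨ε, hε0, hε1, hε⟩ := exists_pos_lt_one_of_continuousAt
        (φ := fun ε => (1 + d * (g + B)) * ((1 - ε) * (d / c)) ^ (-α) + ε * R)
        (s := Set.Iio (g + ρ * B + τ)) (by
          refine ContinuousAt.add (ContinuousAt.mul continuousAt_const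
            (ContinuousAt.rpow_const (by fun_prop) (Or.inl (by simp [hdc.ne'])))) (by fun_prop))
        (gt_mem_nhds (by
          simp only [sub_zero, one_mul, zero_mul, add_zero, ← hR]
          have : (1 + d * (g + B)) * R = (1 + d * g) * R + ρ * B := by rw [hρ]; ring
          rw [this, hfix]
          linarith))
      have hε' : 0 < 1 - ε := by linarith
      have h1 := hXtop.eventually (h.W_eventually_le hU (fun x _ => (one_mul _).ge)
        (fun x _ => hC x) hε0 hε1 hε0)
      have h2 := (hXtop.const_mul_atTop hε').eventually hbd
      have h3 := ((hXs (1 - ε) hε').const_mul (1 + d * (g + B))).add (hX1.const_mul ε)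
      filter_upwards [h1, h2, h3.eventually (gt_mem_nhds hε)] with y h1 h2 h3
      rw [← heq, hXeq] at h1
      rw [mul_div_assoc', mul_div_assoc', ← add_div, div_lt_iff₀ (hU.pos y)] at h3
      have h4 : d * V ((1 - ε) * X y) ≤ d * ((g + B) * U ((1 - ε) * X y)) := by
        gcongr
        linarith [(abs_le.1 h2).2]
      linarith
    have hlo : ∀ᶠ y in atTop, (g - ρ * B - τ) * U y ≤ V y := by
      obtain ⟨ε, hε0, hε1, hε⟩ := exists_pos_lt_one_of_continuousAt
        (φ := fun ε => (1 - ε) * ((1 + ε) * (d / c)) ^ (-α) + (d - ε) * (g - B) * R)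
        (s := Set.Ioi (g - ρ * B - τ)) (by
          refine ContinuousAt.add (ContinuousAt.mul (by fun_prop)
            (ContinuousAt.rpow_const (by fun_prop) (Or.inl (by simp [hdc.ne'])))) (by fun_prop))
        (lt_mem_nhds (by
          simp only [sub_zero, one_mul, add_zero, ← hR]
          have : R + d * (g - B) * R = (1 + d * g) * R - ρ * B := by rw [hρ]; ring
          rw [this, hfix]
          linarith))
      have h1 := hXtop.eventually (h.eventually_le_W hε0 hε0)
      have h2 := hXtop.eventually hbd
      have h3 := ((hXs (1 + ε) (by linarith)).const_mul (1 - ε)).add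
        (hX1.const_mul ((d - ε) * (g - B)))
      filter_upwards [h1, h2, h3.eventually (lt_mem_nhds hε)] with y h1 h2 h3
      rw [← heq, hXeq] at h1
      rw [mul_div_assoc', mul_div_assoc', ← add_div, lt_div_iff₀ (hU.pos y)] at h3
      have h4 : (d - ε) * ((g - B) * U (X y)) ≤ (d - ε) * V (X y) := by
        -- Nonnegativity of d - ε follows from ε < 1 ≤ d.
        refine mul_le_mul_of_nonneg_left ?_ (by linarith)
        linarith [(abs_le.1 h2).1]
      linarith
    filter_upwards [hup, hlo] with y h1 h2
    rw [abs_le]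
    constructor <;> linarith
  have hC0 : 0 ≤ C := by
    by_contra hc
    nlinarith [hC 0, h.V_nonneg 0, hU.pos 0]
  set ρ' := (1 + ρ) / 2 with hρ'_def
  have hiter : ∀ n : ℕ, ∀ᶠ y in atTop, |V y - g * U y| ≤ ρ' ^ n * (C + g) * U y := by
    intro n
    induction n with
    | zero =>
      refine Eventually.of_forall fun y => ?_
      have := hC y
      have := h.V_nonneg y
      have := mul_pos hg0 (hU.pos y)
      have := mul_nonneg hC0 (hU.pos y).le
      rw [pow_zero, one_mul, abs_le]
      constructor <;> linarith
    | succ n ih =>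
      -- With this τ the new error ρB + τ is exactly ρ'B, where ρ' lies strictly between ρ and 1.
      have hτ : 0 < (ρ' - ρ) * (ρ' ^ n * (C + g)) := by
        have : 0 < ρ' - ρ := by rw [hρ'_def]; linarith
        have : 0 < ρ' := by rw [hρ'_def]; linarith
        positivity
      have hB : 0 ≤ ρ' ^ n * (C + g) := by
        have : 0 < ρ' := by rw [hρ'_def]; linarith
        positivity
      filter_upwards [hstep _ _ hB hτ ih] with y hy
      refine hy.trans (le_of_eq ?_)
      ring
  have hlim : Tendsto (fun n : ℕ => ρ' ^ n * (C + g)) atTop (𝓝 0) := by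
    have := (tendsto_pow_atTop_nhds_zero_of_lt_one (r := ρ') (by rw [hρ'_def]; linarith)
      (by rw [hρ'_def]; linarith)).mul_const (C + g)
    rwa [zero_mul] at this
  rw [Metric.tendsto_nhds]
  intro e he
  obtain ⟨n, hn⟩ := (hlim.eventually (gt_mem_nhds he)).exists
  filter_upwards [hiter n] with y hy
  have hUy := hU.pos y
  rw [Real.dist_eq, div_sub' hUy.ne', abs_div, abs_of_pos hUy, div_lt_iff₀ hUy, mul_comm (U y) g]
  exact hy.trans_lt (by gcongr)

end CompoundTail

/-! ### Sums of i.i.d. nonnegative variables of mean one. -/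

section RandomSum

variable {Ω : Type*} [MeasurableSpace Ω] {P : Measure Ω} [IsProbabilityMeasure P]
  {X : ℕ → Ω → ℝ} {M : Ω → ℕ}

/-- By convexity the exponential lies below its chord on [0, θb]. -/
theorem exp_mul_le_of_mem_Icc {θ b y : ℝ} (hb : 0 < b) (h0 : 0 ≤ y) (hy : y ≤ b) :
    Real.exp (θ * y) ≤ 1 + (Real.exp (θ * b) - 1) / b * y := by
  have h := convexOn_exp.2 (Set.mem_univ 0) (Set.mem_univ (θ * b))
    (show 0 ≤ 1 - y / b by rw [sub_nonneg, div_le_one hb]; exact hy)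
    (show 0 ≤ y / b by positivity) (by ring)
  simp only [smul_eq_mul, mul_zero, zero_add, Real.exp_zero, mul_one] at h
  have e : y / b * (θ * b) = θ * y := by field_simp
  rw [e] at h
  refine h.trans (le_of_eq ?_)
  ring

theorem mgf_min_le (hX0 : ∀ ω, 0 ≤ X 0 ω) (hint : Integrable (X 0) P)
    (hmean : ∫ ω, X 0 ω ∂P = 1) {θ b : ℝ} (hθ : 0 ≤ θ) (hb : 0 < b) :
    mgf (fun ω => min (X 0 ω) b) P θ ≤ Real.exp ((Real.exp (θ * b) - 1) / b) := by
  have hk : 0 ≤ (Real.exp (θ * b) - 1) / b := by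
    have : 1 ≤ Real.exp (θ * b) := Real.one_le_exp (by positivity)
    exact div_nonneg (by linarith) hb.le
  have hle : mgf (fun ω => min (X 0 ω) b) P θ ≤
      ∫ ω, (1 + (Real.exp (θ * b) - 1) / b * X 0 ω) ∂P := by
    refine integral_mono_of_nonneg (ae_of_all _ fun ω => (Real.exp_pos _).le)
      ((integrable_const _).add (hint.const_mul _)) (ae_of_all _ fun ω => ?_)
    refine (exp_mul_le_of_mem_Icc hb (le_min (hX0 ω) hb.le) (min_le_right _ _)).trans ?_
    have := mul_le_mul_of_nonneg_left (min_le_left (X 0 ω) b) hk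
    simpa using this
  rw [integral_add (integrable_const _) (hint.const_mul _), integral_const_mul, hmean] at hle
  simp only [integral_const, probReal_univ, smul_eq_mul, mul_one] at hle
  refine hle.trans ?_
  rw [add_comm]
  exact Real.add_one_le_exp _

/-- An exponential Chebyshev bound for sums of truncated variables of mean at most `1`. -/
theorem measureReal_sum_min_le (hX : ∀ i, Measurable (X i)) (hX0 : ∀ i ω, 0 ≤ X i ω)
    (hindep : iIndepFun X P) (hident : ∀ i, IdentDistrib (X i) (X 0) P P)
    (hint : Integrable (X 0) P) (hmean : ∫ ω, X 0 ω ∂P = 1) {n q : ℕ} {x : ℝ} (hx : 0 < x)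
    (hq : 0 < q) (hn : (n : ℝ) ≤ x) :
    P.real {ω | x < ∑ j ∈ Finset.range n, min (X j ω) (x / q)} ≤
      (Real.exp 1 * n / x) ^ q := by
  rcases Nat.eq_zero_or_pos n with rfl | hn0
  · simp [hx.not_gt, hq.ne']
  have hn0' : (0 : ℝ) < n := Nat.cast_pos.2 hn0
  have hq' : (0 : ℝ) < q := Nat.cast_pos.2 hq
  set b := x / q with hb
  have hb0 : 0 < b := by positivity
  -- Chosen so that exp(θb) = x/n, whence θx = q log(x/n); n ≤ x ensures θ ≥ 0.
  set θ := Real.log (x / n) / b with hθ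
  have hθ0 : 0 ≤ θ := div_nonneg (Real.log_nonneg ((one_le_div hn0').2 hn)) hb0.le
  have hθb : Real.exp (θ * b) = x / n := by
    rw [hθ, div_mul_cancel₀ _ hb0.ne', Real.exp_log (by positivity)]
  set Y : ℕ → Ω → ℝ := fun j ω => min (X j ω) b with hY
  have hYm : ∀ j, Measurable (Y j) := fun j => (hX j).min measurable_const
  have hYi : iIndepFun Y P :=
    hindep.comp (fun _ y => min y b) fun _ => measurable_id.min measurable_const
  have hYmgf : ∀ j, mgf (Y j) P θ = mgf (Y 0) P θ := fun j =>
    mgf_congr_of_identDistrib _ _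
      ((hident j).comp (measurable_id.min measurable_const : Measurable fun y : ℝ => min y b)) θ
  have hsumle : ∀ ω, (∑ j ∈ Finset.range n, Y j) ω ≤ n * b := by
    intro ω
    rw [Finset.sum_apply]
    refine (Finset.sum_le_card_nsmul _ _ b fun j _ => min_le_right _ _).trans ?_
    simp
  have hexpint : Integrable (fun ω => Real.exp (θ * (∑ j ∈ Finset.range n, Y j) ω)) P := by
    refine Integrable.of_bound (C := Real.exp (θ * (n * b))) ?_ (ae_of_all _ fun ω => ?_)
    · simp only [Finset.sum_apply]
      exact (((Finset.measurable_sum _ fun j _ => hYm j).const_mul θ).exp).aestronglyMeasurable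
    · rw [Real.norm_eq_abs, Real.abs_exp]
      gcongr
      exact hsumle ω
  calc P.real {ω | x < ∑ j ∈ Finset.range n, min (X j ω) b}
      ≤ P.real {ω | x ≤ (∑ j ∈ Finset.range n, Y j) ω} := by
        refine measureReal_mono (fun ω hω => ?_)
        simp only [Set.mem_ofPred_eq, Finset.sum_apply] at hω ⊢
        exact hω.le
    _ ≤ Real.exp (-θ * x) * mgf (∑ j ∈ Finset.range n, Y j) P θ :=
        measure_ge_le_exp_mul_mgf x hθ0 hexpint
    _ = Real.exp (-θ * x) * (mgf (Y 0) P θ) ^ n := by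
        rw [hYi.mgf_sum hYm, Finset.prod_congr rfl fun j _ => hYmgf j]
        simp
    _ ≤ Real.exp (-θ * x) * (Real.exp ((Real.exp (θ * b) - 1) / b)) ^ n := by
        gcongr
        · exact mgf_nonneg
        · exact mgf_min_le (hX0 0) hint hmean hθ0 hb0
    _ = Real.exp (-θ * x + n * ((x / n - 1) / b)) := by
        rw [hθb, ← Real.exp_nat_mul, ← Real.exp_add]
    _ ≤ Real.exp (q * (1 - Real.log (x / n))) := by
        gcongr
        have h1 : θ * x = q * Real.log (x / n) := by rw [hθ, hb]; field_simp
        have h2 : n * ((x / n - 1) / b) = q - q * n / x := by rw [hb]; field_simp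
        have h3 : 0 ≤ q * n / x := by positivity
        linarith
    _ = (Real.exp 1 * n / x) ^ q := by
        rw [Real.exp_nat_mul, Real.exp_sub, Real.exp_log (by positivity)]
        congr 1
        field_simp

theorem measureReal_lt_sum_le (hX0 : ∀ i ω, 0 ≤ X i ω)
    (hident : ∀ i, IdentDistrib (X i) (X 0) P P)
    (hint : Integrable (X 0) P) (hmean : ∫ ω, X 0 ω ∂P = 1) (s : Finset ℕ) {x : ℝ} (hx : 0 < x) :
    P.real {ω | x < ∑ j ∈ s, X j ω} ≤ s.card / x := by
  have hi : ∀ j ∈ s, Integrable (X j) P := fun j _ => (hident j).integrable_iff.2 hint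
  have h := mul_meas_ge_le_integral_of_nonneg (μ := P) (f := fun ω => ∑ j ∈ s, X j ω)
    (ae_of_all _ fun ω => Finset.sum_nonneg fun j _ => hX0 j ω) (integrable_finsetSum s hi) x
  rw [integral_finsetSum s hi, Finset.sum_congr rfl fun j _ => (hident j).integral_eq.trans hmean]
    at h
  rw [le_div_iff₀ hx, mul_comm]
  refine le_trans (mul_le_mul_of_nonneg_left (measureReal_mono fun ω hω => ?_) hx.le)
    (h.trans (by simp))
  exact (Set.mem_ofPred_eq ▸ hω : _ < _).le

/-- One big summand, two fairly big ones, or a sum of small ones. -/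
theorem tailFun_sum_le (hX : ∀ i, Measurable (X i)) (hX0 : ∀ i ω, 0 ≤ X i ω)
    (hindep : iIndepFun X P) (hident : ∀ i, IdentDistrib (X i) (X 0) P P)
    (hint : Integrable (X 0) P) (hmean : ∫ ω, X 0 ω ∂P = 1) {n q : ℕ} {x δ : ℝ} (hx : 0 < x)
    (hδ : 0 < δ) (hq : 0 < q) (hn : (n : ℝ) ≤ x) :
    tailFun P (fun ω => ∑ j ∈ Finset.range n, X j ω) x ≤
      n * tailFun P (X 0) ((1 - δ) * x) + n * tailFun P (X 0) (x / q) * (n / (δ * x)) +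
        (Real.exp 1 * n / x) ^ q := by
  have hV : ∀ j y, P.real {ω | y < X j ω} = tailFun P (X 0) y := fun j y =>
    congrArg ENNReal.toReal ((hident j).measure_mem_eq (s := Set.Ioi y) measurableSet_Ioi)
  have hsub : {ω | x < ∑ j ∈ Finset.range n, X j ω} ⊆
      ((⋃ j ∈ Finset.range n, {ω | (1 - δ) * x < X j ω}) ∪
        (⋃ j ∈ Finset.range n, {ω | δ * x < ∑ i ∈ (Finset.range n).erase j, X i ω} ∩
          {ω | x / q < X j ω})) ∪
        {ω | x < ∑ j ∈ Finset.range n, min (X j ω) (x / q)} := by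
    intro ω hω
    simp only [Set.mem_ofPred_eq] at hω
    by_cases h1 : ∃ j ∈ Finset.range n, x / q < X j ω
    · obtain ⟨j, hj, hjx⟩ := h1
      left
      rcases lt_or_ge ((1 - δ) * x) (X j ω) with h2 | h2
      · left
        simp only [Set.mem_iUnion]
        exact ⟨j, hj, h2⟩
      · right
        simp only [Set.mem_iUnion]
        refine ⟨j, hj, ?_, hjx⟩
        -- If X_j ≤ (1-δ)x, the other summands exceed δx; they are independent of X_j, and Markov's
        -- inequality handles them.
        rw [← Finset.add_sum_erase _ _ hj] at hω
        simp only [Set.mem_ofPred_eq]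
        linarith
    · right
      push Not at h1
      simp only [Set.mem_ofPred_eq]
      rwa [Finset.sum_congr rfl fun j hj => min_eq_left (h1 j hj)]
  have hA : P.real (⋃ j ∈ Finset.range n, {ω | (1 - δ) * x < X j ω}) ≤
      n * tailFun P (X 0) ((1 - δ) * x) := by
    refine (measureReal_biUnion_finset_le _ _).trans ?_
    simp [hV]
  have hB : P.real (⋃ j ∈ Finset.range n, {ω | δ * x < ∑ i ∈ (Finset.range n).erase j, X i ω} ∩
      {ω | x / q < X j ω}) ≤ n * tailFun P (X 0) (x / q) * (n / (δ * x)) := by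
    refine (measureReal_biUnion_finset_le _ _).trans ?_
    have hj : ∀ j ∈ Finset.range n,
        P.real ({ω | δ * x < ∑ i ∈ (Finset.range n).erase j, X i ω} ∩ {ω | x / q < X j ω}) ≤
          tailFun P (X 0) (x / q) * (n / (δ * x)) := by
      intro j _
      have hi := hindep.indepFun_finsetSum_of_notMem hX (s := (Finset.range n).erase j) (i := j)
        (Finset.notMem_erase _ _)
      have h1 := congrArg ENNReal.toReal (hi.measure_inter_preimage_eq_mul (Set.Ioi (δ * x))
        (Set.Ioi (x / q)) measurableSet_Ioi measurableSet_Ioi)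
      rw [ENNReal.toReal_mul] at h1
      have e1 : (∑ i ∈ (Finset.range n).erase j, X i) ⁻¹' Set.Ioi (δ * x) =
          {ω | δ * x < ∑ i ∈ (Finset.range n).erase j, X i ω} := by
        ext ω
        simp [Finset.sum_apply]
      rw [e1] at h1
      refine h1.le.trans ?_
      rw [mul_comm]
      refine mul_le_mul (hV j _).le ?_ measureReal_nonneg measureReal_nonneg
      refine (measureReal_lt_sum_le hX0 hident hint hmean _ (by positivity)).trans ?_
      gcongr
      exact (Finset.card_le_card (Finset.erase_subset _ _)).trans (Finset.card_range n).le
    refine (Finset.sum_le_card_nsmul _ _ _ hj).trans (le_of_eq ?_)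
    rw [Finset.card_range, nsmul_eq_mul, mul_assoc]
  have hC := measureReal_sum_min_le hX hX0 hindep hident hint hmean hx hq hn
  refine (measureReal_mono hsub).trans ((measureReal_union_le _ _).trans ?_)
  exact add_le_add ((measureReal_union_le _ _).trans (add_le_add hA hB)) hC

theorem one_sub_pow_le {v : ℝ} (h0 : 0 ≤ v) (h1 : v ≤ 1) (n : ℕ) :
    (1 - v) ^ n ≤ 1 - n * v + (n * v) ^ 2 := by
  induction n with
  | zero => simp
  | succ n ih =>
    have h2 := mul_le_mul_of_nonneg_right ih (by linarith : 0 ≤ 1 - v)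
    have hn : (0 : ℝ) ≤ n := n.cast_nonneg
    rw [pow_succ]
    push_cast
    refine h2.trans ?_
    have : 0 ≤ (n : ℝ) ^ 2 * v ^ 2 * v := by positivity
    have : 0 ≤ n * v ^ 2 := by positivity
    nlinarith [sq_nonneg v]

/-- By nonnegativity it suffices that one summand exceeds x, which has probability 1 - (1-v)^n with
v the single tail; `one_sub_pow_le` expands this. -/
theorem le_tailFun_sum (hX : ∀ i, Measurable (X i)) (hX0 : ∀ i ω, 0 ≤ X i ω)
    (hindep : iIndepFun X P) (hident : ∀ i, IdentDistrib (X i) (X 0) P P) (n : ℕ) (x : ℝ) :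
    n * tailFun P (X 0) x - (n * tailFun P (X 0) x) ^ 2 ≤
      tailFun P (fun ω => ∑ j ∈ Finset.range n, X j ω) x := by
  have hle : ∀ j, P.real (X j ⁻¹' Set.Iic x) = 1 - tailFun P (X 0) x := by
    intro j
    have h1 : P.real (X j ⁻¹' Set.Iic x) = P.real (X 0 ⁻¹' Set.Iic x) :=
      congrArg ENNReal.toReal ((hident j).measure_mem_eq measurableSet_Iic)
    have h2 : {ω | x < X 0 ω} = (X 0 ⁻¹' Set.Iic x)ᶜ := by ext ω; simp
    rw [h1, tailFun, h2, probReal_compl_eq_one_sub (hX 0 measurableSet_Iic)]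
    ring
  have h1 := congrArg ENNReal.toReal (hindep.measure_inter_preimage_eq_mul (Finset.range n)
    (sets := fun _ => Set.Iic x) fun _ _ => measurableSet_Iic)
  rw [ENNReal.toReal_prod] at h1
  change P.real _ = ∏ j ∈ Finset.range n, P.real _ at h1
  rw [Finset.prod_congr rfl fun j _ => hle j, Finset.prod_const, Finset.card_range] at h1
  have hm : MeasurableSet (⋂ j ∈ Finset.range n, X j ⁻¹' Set.Iic x) :=
    Finset.measurableSet_biInter _ fun j _ => hX j measurableSet_Iic
  have hsub : (⋂ j ∈ Finset.range n, X j ⁻¹' Set.Iic x)ᶜ ⊆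
      {ω | x < ∑ j ∈ Finset.range n, X j ω} := by
    intro ω hω
    simp only [Set.mem_compl_iff, Set.mem_iInter, Set.mem_preimage, Set.mem_Iic, not_forall,
      not_le] at hω
    obtain ⟨j, hj, hjx⟩ := hω
    exact hjx.trans_le (Finset.single_le_sum (f := fun j => X j ω) (fun i _ => hX0 i ω) hj)
  have h2 := measureReal_mono hsub (μ := P)
  rw [probReal_compl_eq_one_sub hm, h1] at h2
  have h3 := one_sub_pow_le (v := tailFun P (X 0) x) measureReal_nonneg measureReal_le_one n
  exact le_trans (by linarith) h2

theorem tendstoInMeasure_sum_div (hX : ∀ i, Measurable (X i))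
    (hindep : iIndepFun X P) (hident : ∀ i, IdentDistrib (X i) (X 0) P P)
    (hint : Integrable (X 0) P) (hmean : ∫ ω, X 0 ω ∂P = 1) {ε : ℝ} (hε : 0 < ε) :
    Tendsto (fun n : ℕ => P.real {ω | ε ≤ dist ((∑ j ∈ Finset.range n, X j ω) / n) 1})
      atTop (𝓝 0) := by
  have h := strong_law_ae_real X hint (fun i j hij => hindep.indepFun hij) hident
  rw [hmean] at h
  have h2 := tendstoInMeasure_of_tendsto_ae (fun n : ℕ =>
    ((Finset.measurable_sum (Finset.range n) fun j _ => hX j).div_const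
      (n : ℝ)).aestronglyMeasurable) (by simpa only [Finset.sum_apply] using h)
  exact (tendstoInMeasure_iff_measureReal_dist.1 h2 ε hε).congr fun _ => rfl

theorem tendsto_tailFun_sum_above (hX : ∀ i, Measurable (X i))
    (hindep : iIndepFun X P) (hident : ∀ i, IdentDistrib (X i) (X 0) P P)
    (hint : Integrable (X 0) P) (hmean : ∫ ω, X 0 ω ∂P = 1) {s : ℝ} (hs : 1 < s) :
    Tendsto (fun n : ℕ => tailFun P (fun ω => ∑ j ∈ Finset.range n, X j ω) (s * n))
      atTop (𝓝 0) := by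
  refine squeeze_zero' (Eventually.of_forall fun n => measureReal_nonneg) ?_
    (tendstoInMeasure_sum_div hX hindep hident hint hmean (sub_pos.2 hs))
  filter_upwards [eventually_gt_atTop 0] with n hn
  refine measureReal_mono fun ω hω => ?_
  simp only [Set.mem_ofPred_eq] at hω ⊢
  have hn' : (0 : ℝ) < n := Nat.cast_pos.2 hn
  rw [Real.dist_eq]
  refine le_trans ?_ (le_abs_self _)
  have := (le_div_iff₀ hn').2 hω.le
  linarith

theorem tendsto_tailFun_sum_below (hX : ∀ i, Measurable (X i))
    (hindep : iIndepFun X P) (hident : ∀ i, IdentDistrib (X i) (X 0) P P)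
    (hint : Integrable (X 0) P) (hmean : ∫ ω, X 0 ω ∂P = 1) {s : ℝ} (hs : s < 1) :
    Tendsto (fun n : ℕ => tailFun P (fun ω => ∑ j ∈ Finset.range n, X j ω) (s * n))
      atTop (𝓝 1) := by
  have h := (tendstoInMeasure_sum_div hX hindep hident hint hmean (sub_pos.2 hs)).const_sub 1
  rw [sub_zero] at h
  refine tendsto_of_tendsto_of_tendsto_of_le_of_le' h tendsto_const_nhds ?_
    (Eventually.of_forall fun n => measureReal_le_one)
  filter_upwards [eventually_gt_atTop 0] with n hn
  have hn' : (0 : ℝ) < n := Nat.cast_pos.2 hn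
  have hm : MeasurableSet {ω | s * n < ∑ j ∈ Finset.range n, X j ω} :=
    measurableSet_lt measurable_const (Finset.measurable_fun_sum _ fun j _ => hX j)
  have h2 := probReal_compl_eq_one_sub (μ := P) hm
  have h3 : P.real {ω | s * n < ∑ j ∈ Finset.range n, X j ω}ᶜ ≤
      P.real {ω | 1 - s ≤ dist ((∑ j ∈ Finset.range n, X j ω) / n) 1} := by
    refine measureReal_mono fun ω hω => ?_
    simp only [Set.mem_compl_iff, Set.mem_ofPred_eq, not_lt] at hω ⊢
    rw [Real.dist_eq]
    refine le_trans ?_ (neg_le_abs _)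
    have := (div_le_iff₀ hn').2 hω
    linarith
  rw [tailFun]
  linarith

theorem hasSum_measureReal_fiber_inter (hM : Measurable M) {A : Set Ω} (hA : MeasurableSet A) :
    HasSum (fun n => P.real (M ⁻¹' {n} ∩ A)) (P.real A) := by
  have h1 : A = ⋃ n, M ⁻¹' {n} ∩ A := by ext ω; simp
  have h2 : P A = ∑' n, P (M ⁻¹' {n} ∩ A) := by
    conv_lhs => rw [h1]
    refine measure_iUnion (fun i j hij => ?_) fun n => (hM (measurableSet_singleton n)).inter hA
    refine Set.disjoint_left.2 fun ω hi hj => hij ?_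
    rw [← hi.1, ← hj.1]
  have h3 : P.real A = ∑' n, P.real (M ⁻¹' {n} ∩ A) := by
    rw [measureReal_def, h2, ENNReal.tsum_toReal_eq fun n => measure_ne_top _ _]
    rfl
  rw [h3]
  refine Summable.hasSum (ENNReal.summable_toReal ?_)
  rw [← h2]
  exact measure_ne_top _ _

theorem tailFun_anti (X : Ω → ℝ) : Antitone (tailFun P X) := fun _ _ hxy =>
  measureReal_mono fun _ hω => lt_of_le_of_lt hxy hω

/-- `sum_W` is the law of total probability over the value of `M`, with independence factoring each
term. -/
theorem compoundTail_of_indep {d : ℝ} (hX : ∀ i, Measurable (X i)) (hX0 : ∀ i ω, 0 ≤ X i ω)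
    (hindep : iIndepFun X P) (hident : ∀ i, IdentDistrib (X i) (X 0) P P)
    (hint : Integrable (X 0) P) (hmean : ∫ ω, X 0 ω ∂P = 1) (hM : Measurable M)
    (hXM : IndepFun (fun ω j => X j ω) M P)
    (hd : HasSum (fun n : ℕ => n * P.real (M ⁻¹' {n})) d) :
    CompoundTail d (fun n => P.real (M ⁻¹' {n}))
      (fun n => tailFun P fun ω => ∑ j ∈ Finset.range n, X j ω) (tailFun P fun ω => (M ω : ℝ))
      (tailFun P (X 0)) (tailFun P fun ω => ∑ j ∈ Finset.range (M ω), X j ω) where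
  p_nonneg n := measureReal_nonneg
  sum_p := by simpa using hasSum_measureReal_fiber_inter (P := P) hM MeasurableSet.univ
  sum_mul_p := hd
  U_eq z hz := by
    rw [sum_measureReal_preimage_singleton _ fun n _ => hM (measurableSet_singleton n),
      ← probReal_compl_eq_one_sub (hM (Finset.measurableSet _)), tailFun]
    congr 1
    ext ω
    simp [← Nat.floor_lt hz]
  V_nonneg x := measureReal_nonneg
  V_le_one x := measureReal_le_one
  V_le_inv x hx := by
    simpa [tailFun] using measureReal_lt_sum_le hX0 hident hint hmean {0} hx
  F_nonneg n x := measureReal_nonneg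
  F_le_one n x := measureReal_le_one
  F_anti n := tailFun_anti _
  F_le n x δ q hx hδ hq hn := tailFun_sum_le hX hX0 hindep hident hint hmean hx hδ hq hn
  le_F n x _ := le_tailFun_sum hX hX0 hindep hident n x
  F_above s hs := tendsto_tailFun_sum_above hX hindep hident hint hmean hs
  F_below s hs := tendsto_tailFun_sum_below hX hindep hident hint hmean hs
  sum_W x := by
    have hSm : ∀ n, MeasurableSet {ω | x < ∑ j ∈ Finset.range n, X j ω} := fun n =>
      measurableSet_lt measurable_const (Finset.measurable_fun_sum _ fun j _ => hX j)
    have hinter : ∀ n, M ⁻¹' {n} ∩ {ω | x < ∑ j ∈ Finset.range (M ω), X j ω} =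
        {ω | x < ∑ j ∈ Finset.range n, X j ω} ∩ M ⁻¹' {n} := by
      intro n
      ext ω
      simp only [Set.mem_inter_iff, Set.mem_preimage, Set.mem_singleton_iff, Set.mem_ofPred_eq]
      constructor
      · rintro ⟨rfl, h⟩; exact ⟨h, rfl⟩
      · rintro ⟨h, rfl⟩; exact ⟨rfl, h⟩
    have hA : MeasurableSet {ω | x < ∑ j ∈ Finset.range (M ω), X j ω} := by
      have : {ω | x < ∑ j ∈ Finset.range (M ω), X j ω} =
          ⋃ n, M ⁻¹' {n} ∩ {ω | x < ∑ j ∈ Finset.range (M ω), X j ω} := by ext ω; simp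
      rw [this]
      refine MeasurableSet.iUnion fun n => ?_
      rw [hinter]
      exact (hSm n).inter (hM (measurableSet_singleton n))
    refine (hasSum_measureReal_fiber_inter hM hA).congr_fun fun n => ?_
    rw [hinter]
    have h1 := hXM.measure_inter_preimage_eq_mul {f : ℕ → ℝ | x < ∑ j ∈ Finset.range n, f j} {n}
      (measurableSet_lt measurable_const
        (Finset.measurable_fun_sum _ fun j _ => measurable_pi_apply j))
      (measurableSet_singleton n)
    have h2 := congrArg ENNReal.toReal h1
    rw [ENNReal.toReal_mul, mul_comm] at h2
    exact h2.symm

end RandomSum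

/-! ### The Poisson process at an independent random time. -/

theorem lintegral_natCast_poissonMeasure (r : ℝ≥0) :
    ∫⁻ n : ℕ, (n : ENNReal) ∂poissonMeasure r = r := by
  have h1 : HasSum (fun n : ℕ => (n : ℝ) * (Real.exp (-r) * r ^ n / n.factorial)) r := by
    rw [← hasSum_nat_add_iff' 1]
    have h := (hasSum_one_poissonMeasure r).mul_left (r : ℝ)
    rw [mul_one] at h
    simp only [Finset.range_one, Finset.sum_singleton, Nat.cast_zero, zero_mul, sub_zero]
    refine h.congr_fun fun n => ?_
    rw [Nat.factorial_succ]
    push_cast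
    field_simp
    ring
  rw [lintegral_countable']
  have h2 : ∀ n : ℕ, (n : ENNReal) * poissonMeasure r {n} =
      ENNReal.ofReal ((n : ℝ) * (Real.exp (-r) * r ^ n / n.factorial)) := by
    intro n
    rw [poissonMeasure_singleton, ENNReal.ofReal_mul n.cast_nonneg, ENNReal.ofReal_natCast]
  simp_rw [h2]
  rw [← ENNReal.ofReal_tsum_of_nonneg (fun n => by positivity) h1.summable, h1.tsum_eq,
    ENNReal.ofReal_coe_nnreal]

section PoissonProcess

variable {Ω : Type*} [MeasurableSpace Ω] {P : Measure Ω} {N : ℝ≥0 → Ω → ℕ} {T : Ω → ℝ≥0}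

theorem IsUnitPoissonProcess.lintegral_eq (hN : IsUnitPoissonProcess N P) (t : ℝ≥0) :
    ∫⁻ ω, (N t ω : ENNReal) ∂P = t := by
  have h1 : ∫⁻ ω, (N t ω : ENNReal) ∂P = ∫⁻ ω, ((N t ω - N 0 ω : ℕ) : ENNReal) ∂P := by
    refine lintegral_congr_ae ?_
    filter_upwards [hN.start] with ω h0
    rw [h0, Nat.sub_zero]
  rw [h1, (hN.law 0 t zero_le).lintegral_comp (f := fun n : ℕ => (n : ENNReal))
    measurable_from_top.aemeasurable, tsub_zero, lintegral_natCast_poissonMeasure]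

theorem tsum_indicator_eq {Ω : Type*} (J : Ω → ℕ) (f : ℕ → Ω → ENNReal) (ω : Ω) :
    ∑' j, (J ⁻¹' {j}).indicator 1 ω * f j ω = f (J ω) ω := by
  rw [tsum_eq_single (J ω)]
  · simp
  · intro j hj
    rw [Set.indicator_of_notMem (by simpa using hj.symm), zero_mul]

/-- The mean of a unit-rate Poisson process sampled at a random time with countably many values. -/
theorem IsUnitPoissonProcess.lintegral_comp_countable (hN : IsUnitPoissonProcess N P)
    (hT : Measurable T) (hNT : IndepFun (fun ω t => N t ω) T P) {ψ : ℝ≥0 → ℕ} (hψ : Measurable ψ)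
    (g : ℕ → ℝ≥0) :
    ∫⁻ ω, (N (g (ψ (T ω))) ω : ENNReal) ∂P = ∫⁻ ω, (g (ψ (T ω)) : ENNReal) ∂P := by
  set J : Ω → ℕ := fun ω => ψ (T ω) with hJ
  have hJm : Measurable J := hψ.comp hT
  have hind : ∀ j, Measurable ((J ⁻¹' {j}).indicator (1 : Ω → ENNReal)) := fun j =>
    measurable_one.indicator (hJm (measurableSet_singleton j))
  have hNm : ∀ j, Measurable fun ω => (N (g j) ω : ENNReal) := fun j =>
    measurable_from_top.comp (hN.measurable (g j))
  have hprod : ∀ j, Measurable fun ω =>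
      (J ⁻¹' {j}).indicator (1 : Ω → ENNReal) ω * (N (g j) ω : ENNReal) := fun j =>
    (hind j).mul (hNm j)
  have h1 := fun ω => (tsum_indicator_eq J (fun j ω => (N (g j) ω : ENNReal)) ω).symm
  have h2 := fun ω => (tsum_indicator_eq J (fun j _ => (g j : ENNReal)) ω).symm
  calc ∫⁻ ω, (N (g (J ω)) ω : ENNReal) ∂P
      = ∑' j, ∫⁻ ω, (J ⁻¹' {j}).indicator 1 ω * (N (g j) ω : ENNReal) ∂P := by
        rw [lintegral_congr h1, lintegral_tsum fun j => (hprod j).aemeasurable]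
    _ = ∑' j, ∫⁻ ω, (J ⁻¹' {j}).indicator 1 ω * (g j : ENNReal) ∂P := by
        congr 1
        funext j
        have hi : IndepFun ((J ⁻¹' {j}).indicator (1 : Ω → ENNReal))
            (fun ω => (N (g j) ω : ENNReal)) P := by
          have := (hNT.comp
            (φ := fun f : ℝ≥0 → ℕ => (f (g j) : ENNReal))
            (ψ := (ψ ⁻¹' {j}).indicator (1 : ℝ≥0 → ENNReal))
            (measurable_from_top.comp (measurable_pi_apply (g j)))
            (measurable_one.indicator (hψ (measurableSet_singleton j)))).symm
          exact this
        rw [lintegral_mul_eq_lintegral_mul_lintegral_of_indepFun'' (hind j).aemeasurable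
          (hNm j).aemeasurable hi, hN.lintegral_eq, lintegral_mul_const _ (hind j)]
    _ = ∫⁻ ω, (g (J ω) : ENNReal) ∂P := by
        rw [lintegral_congr h2, lintegral_tsum fun j => ((hind j).mul_const _).aemeasurable]

theorem floor_div_le (k : ℕ) (t : ℝ≥0) : (⌊(k + 1) * t⌋₊ : ℝ≥0) / (k + 1) ≤ t := by
  rw [div_le_iff₀ (by positivity), mul_comm t]
  exact Nat.floor_le zero_le

theorem le_floor_add_one_div (k : ℕ) (t : ℝ≥0) : t ≤ ((⌊(k + 1) * t⌋₊ : ℝ≥0) + 1) / (k + 1) := by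
  rw [le_div_iff₀ (by positivity), mul_comm t]
  exact (Nat.lt_floor_add_one _).le

theorem measurable_floor_mul (k : ℕ) : Measurable fun t : ℝ≥0 => ⌊((k : ℝ≥0) + 1) * t⌋₊ :=
  Nat.measurable_floor.comp (measurable_id.const_mul _)

/-- Right continuity makes N(T) the almost sure limit of N at grid times decreasing onto T from
above, and N at a countably valued time is measurable. -/
theorem IsUnitPoissonProcess.aemeasurable_comp (hN : IsUnitPoissonProcess N P)
    (hT : Measurable T) : AEMeasurable (fun ω => N (T ω) ω) P := by
  refine aemeasurable_of_tendsto_metrizable_ae atTop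
    (f := fun (k : ℕ) ω => N (((⌊(k + 1) * T ω⌋₊ : ℝ≥0) + 1) / (k + 1)) ω) (fun k => ?_) ?_
  · have h1 : Measurable fun z : ℕ × Ω => N (((z.1 : ℝ≥0) + 1) / (k + 1)) z.2 :=
      measurable_from_prod_countable_right fun j =>
        hN.measurable (((j : ℝ≥0) + 1) / (k + 1))
    exact (h1.comp (((measurable_floor_mul k).comp hT).prodMk measurable_id)).aemeasurable
  · filter_upwards [hN.rightCont] with ω hω
    have h1 : Tendsto (fun k : ℕ => ((⌊(k + 1) * T ω⌋₊ : ℝ≥0) + 1) / (k + 1)) atTop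
        (𝓝 (T ω)) := by
      have h2 : Tendsto (fun k : ℕ => T ω + 1 / ((k : ℝ≥0) + 1)) atTop (𝓝 (T ω + 0)) :=
        tendsto_const_nhds.add tendsto_one_div_add_atTop_nhds_zero_nat
      rw [add_zero] at h2
      refine tendsto_of_tendsto_of_tendsto_of_le_of_le tendsto_const_nhds h2
        (fun k => le_floor_add_one_div k _) fun k => ?_
      rw [add_div]
      gcongr
      exact floor_div_le k _
    exact (hω (T ω)).tendsto.comp (tendsto_nhdsWithin_iff.2
      ⟨h1, Eventually.of_forall fun k => le_floor_add_one_div k _⟩)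

/-- Wald's identity for a unit-rate Poisson process at an independent random time. -/
theorem IsUnitPoissonProcess.lintegral_comp [IsProbabilityMeasure P]
    (hN : IsUnitPoissonProcess N P) (hT : Measurable T)
    (hNT : IndepFun (fun ω t => N t ω) T P) :
    ∫⁻ ω, (N (T ω) ω : ENNReal) ∂P = ∫⁻ ω, (T ω : ENNReal) ∂P := by
  have hlim : ∀ a : ENNReal, Tendsto (fun k : ℕ => a + 1 / ((k : ENNReal) + 1)) atTop (𝓝 a) := by
    intro a
    have h1 := (tendsto_const_nhds (x := a)).add
      ((tendsto_add_atTop_iff_nat 1).2 ENNReal.tendsto_inv_nat_nhds_zero)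
    rw [add_zero] at h1
    exact h1.congr fun k => by simp
  have hadd : ∀ (k : ℕ) (f : Ω → ENNReal), ∫⁻ ω, (f ω + 1 / ((k : ENNReal) + 1)) ∂P =
      ∫⁻ ω, f ω ∂P + 1 / ((k : ENNReal) + 1) := by
    intro k f
    rw [lintegral_add_right _ measurable_const, lintegral_const, measure_univ, mul_one]
  have hcoe : ∀ k : ℕ, ((1 / ((k : ℝ≥0) + 1) : ℝ≥0) : ENNReal) = 1 / ((k : ENNReal) + 1) := by
    intro k
    rw [ENNReal.coe_div (by positivity)]
    simp
  -- Monotone paths sandwich N(T) between its values at neighbouring grid times, where the countable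
  -- case applies; the mesh 1/(k+1) tends to 0.
  refine le_antisymm ?_ ?_
  · refine ge_of_tendsto' (hlim _) fun k => ?_
    calc ∫⁻ ω, (N (T ω) ω : ENNReal) ∂P
        ≤ ∫⁻ ω, (N (((⌊(k + 1) * T ω⌋₊ : ℝ≥0) + 1) / (k + 1)) ω : ENNReal) ∂P := by
          refine lintegral_mono_ae ?_
          filter_upwards [hN.mono] with ω hω
          exact Nat.cast_le.2 (hω (le_floor_add_one_div k _))
      _ = ∫⁻ ω, ((((⌊(k + 1) * T ω⌋₊ : ℝ≥0) + 1) / (k + 1) : ℝ≥0) : ENNReal) ∂P :=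
          hN.lintegral_comp_countable hT hNT (measurable_floor_mul k)
            fun j => ((j : ℝ≥0) + 1) / (k + 1)
      _ ≤ ∫⁻ ω, ((T ω : ENNReal) + 1 / ((k : ENNReal) + 1)) ∂P := by
          refine lintegral_mono fun ω => ?_
          rw [← hcoe, ← ENNReal.coe_add, ENNReal.coe_le_coe, add_div]
          gcongr
          exact floor_div_le k _
      _ = _ := hadd k _
  · refine ge_of_tendsto' (hlim _) fun k => ?_
    calc ∫⁻ ω, (T ω : ENNReal) ∂P
        ≤ ∫⁻ ω, ((((⌊(k + 1) * T ω⌋₊ : ℝ≥0) / (k + 1) : ℝ≥0) : ENNReal) +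
            1 / ((k : ENNReal) + 1)) ∂P := by
          refine lintegral_mono fun ω => ?_
          rw [← hcoe, ← ENNReal.coe_add, ENNReal.coe_le_coe, ← add_div]
          exact le_floor_add_one_div k _
      _ = ∫⁻ ω, (((⌊(k + 1) * T ω⌋₊ : ℝ≥0) / (k + 1) : ℝ≥0) : ENNReal) ∂P +
            1 / ((k : ENNReal) + 1) := hadd k _
      _ = ∫⁻ ω, (N ((⌊(k + 1) * T ω⌋₊ : ℝ≥0) / (k + 1)) ω : ENNReal) ∂P +
            1 / ((k : ENNReal) + 1) := by
          rw [hN.lintegral_comp_countable hT hNT (measurable_floor_mul k)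
            fun j => (j : ℝ≥0) / (k + 1)]
      _ ≤ _ := by
          gcongr ?_ + _
          refine lintegral_mono_ae ?_
          filter_upwards [hN.mono] with ω hω
          exact Nat.cast_le.2 (hω (floor_div_le k _))

end PoissonProcess

/-! ### From the stochastic equation to the functional equation. -/

section Wald

variable {Ω : Type*} [MeasurableSpace Ω] {P : Measure Ω} {X : ℕ → Ω → ℝ} {M : Ω → ℕ}

theorem tsum_indicator_lt (m : ℕ) (a : ℕ → ENNReal) :
    ∑' j, (Set.Ioi j).indicator 1 m * a j = ∑ j ∈ Finset.range m, a j := by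
  rw [tsum_eq_sum (s := Finset.range m)]
  · refine Finset.sum_congr rfl fun j hj => ?_
    rw [Set.indicator_of_mem (by simpa using hj)]
    simp
  · intro j hj
    rw [Set.indicator_of_notMem (by simpa using hj), zero_mul]

/-- Wald's identity for a random sum of nonnegative variables. -/
theorem lintegral_random_sum (hX : ∀ i, Measurable (X i)) (hX0 : ∀ i ω, 0 ≤ X i ω)
    (hident : ∀ i, IdentDistrib (X i) (X 0) P P) (hM : Measurable M)
    (hXM : IndepFun (fun ω j => X j ω) M P) :
    ∫⁻ ω, ENNReal.ofReal (∑ j ∈ Finset.range (M ω), X j ω) ∂P =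
      (∫⁻ ω, (M ω : ENNReal) ∂P) * ∫⁻ ω, ENNReal.ofReal (X 0 ω) ∂P := by
  have hind : ∀ j, Measurable fun ω => (Set.Ioi j).indicator (1 : ℕ → ENNReal) (M ω) := fun j =>
    (measurable_from_top (f := (Set.Ioi j).indicator (1 : ℕ → ENNReal))).comp hM
  have hXm : ∀ j, Measurable fun ω => ENNReal.ofReal (X j ω) := fun j => (hX j).ennreal_ofReal
  have hprod : ∀ j, Measurable fun ω =>
      (Set.Ioi j).indicator (1 : ℕ → ENNReal) (M ω) * ENNReal.ofReal (X j ω) := fun j =>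
    (hind j).mul (hXm j)
  -- The random sum is the series of 1{j < M} X_j, whose factors are independent for each j.
  have h1 : ∀ ω, ENNReal.ofReal (∑ j ∈ Finset.range (M ω), X j ω) =
      ∑' j, (Set.Ioi j).indicator (1 : ℕ → ENNReal) (M ω) * ENNReal.ofReal (X j ω) := by
    intro ω
    rw [tsum_indicator_lt, ENNReal.ofReal_sum_of_nonneg fun j _ => hX0 j ω]
  have h2 : ∀ ω, (M ω : ENNReal) =
      ∑' j, (Set.Ioi j).indicator (1 : ℕ → ENNReal) (M ω) * 1 := by
    intro ω
    rw [tsum_indicator_lt]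
    simp
  rw [lintegral_congr h1, lintegral_tsum fun j => (hprod j).aemeasurable,
    lintegral_congr h2, lintegral_tsum fun j => ((hind j).mul_const 1).aemeasurable,
    ← ENNReal.tsum_mul_right]
  congr 1
  funext j
  have hi : IndepFun (fun ω => (Set.Ioi j).indicator (1 : ℕ → ENNReal) (M ω))
      (fun ω => ENNReal.ofReal (X j ω)) P :=
    (hXM.comp (φ := fun f : ℕ → ℝ => ENNReal.ofReal (f j))
      (ψ := (Set.Ioi j).indicator (1 : ℕ → ENNReal))
      (measurable_pi_apply j).ennreal_ofReal measurable_from_top).symm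
  rw [lintegral_mul_eq_lintegral_mul_lintegral_of_indepFun'' (hind j).aemeasurable
    (hXm j).aemeasurable hi]
  simp only [mul_one]
  congr 1
  exact ((hident j).comp ENNReal.measurable_ofReal).lintegral_eq

theorem hasSum_mul_measureReal_fiber [IsProbabilityMeasure P] (hM : Measurable M) {d : ℝ}
    (hd : 0 ≤ d) (h : ∫⁻ ω, (M ω : ENNReal) ∂P = ENNReal.ofReal d) :
    HasSum (fun n : ℕ => n * P.real (M ⁻¹' {n})) d := by
  have h1 : ∑' n : ℕ, (n : ENNReal) * P (M ⁻¹' {n}) = ENNReal.ofReal d := by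
    rw [← h, ← lintegral_map (f := fun n : ℕ => (n : ENNReal)) measurable_from_top hM,
      lintegral_countable']
    congr 1
    funext n
    rw [Measure.map_apply hM (measurableSet_singleton n)]
  have h2 : (fun n : ℕ => n * P.real (M ⁻¹' {n})) =
      fun n : ℕ => ((n : ENNReal) * P (M ⁻¹' {n})).toReal := by
    funext n
    rw [ENNReal.toReal_mul, ENNReal.toReal_natCast]
    rfl
  have h3 : d = ∑' n : ℕ, ((n : ENNReal) * P (M ⁻¹' {n})).toReal := by
    rw [← ENNReal.tsum_toReal_eq fun n => by finiteness, h1, ENNReal.toReal_ofReal hd]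
  rw [h2]
  conv => arg 2; rw [h3]
  exact (ENNReal.summable_toReal (by rw [h1]; finiteness)).hasSum

end Wald

/-- A solution of the stochastic equation, driven by a number of summands of mean `d`, gives rise
to a `CompoundTail` whose tails satisfy the corresponding functional equation. -/
theorem SolvesPageRankEq.exists_compoundTail {Ω Ω' : Type*} [MeasurableSpace Ω]
    [MeasurableSpace Ω'] {P : Measure Ω} [IsProbabilityMeasure P] {P' : Measure Ω'}
    [IsProbabilityMeasure P'] {c d : ℝ} (hc0 : 0 < c) (hc1 : c < 1) (hd : 0 < d) {M : Ω → ℕ}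
    (hM : AEMeasurable M P) (hMd : ∫⁻ ω, (M ω : ENNReal) ∂P = ENNReal.ofReal d) {R : Ω' → ℝ}
    (hR0 : ∀ᵐ ω ∂P', 0 ≤ R ω) (hRint : Integrable R P') {Rs : ℕ → Ω → ℝ}
    (hR : SolvesPageRankEq c d M Rs P R P') :
    ∃ (p : ℕ → ℝ) (F : ℕ → ℝ → ℝ) (W : ℝ → ℝ),
      CompoundTail d p F (tailFun P fun ω => (M ω : ℝ)) (tailFun P' R) W ∧
        ∀ x, tailFun P' R (c / d * x + (1 - c)) = W x := by
  -- `M` and the copies are replaced by almost surely equal versions that are measurable and, for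
  -- the copies, nonnegative everywhere.
  set M' := hM.mk M with hM'
  have hM'm : Measurable M' := hM.measurable_mk
  have hMM' : M =ᵐ[P] M' := hM.ae_eq_mk
  have hRs : ∀ j, AEMeasurable (Rs j) P := fun j => (hR.copies j).aemeasurable_fst
  set X : ℕ → Ω → ℝ := fun j ω => max ((hRs j).mk (Rs j) ω) 0 with hX
  have hXm : ∀ j, Measurable (X j) := fun j => (hRs j).measurable_mk.max measurable_const
  have hX0 : ∀ j ω, 0 ≤ X j ω := fun j ω => le_max_right _ _
  have hRX : ∀ j, Rs j =ᵐ[P] X j := by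
    intro j
    have h0 : ∀ᵐ ω ∂P, 0 ≤ Rs j ω := (hR.copies j).symm.ae_snd measurableSet_Ici hR0
    filter_upwards [(hRs j).ae_eq_mk, h0] with ω h1 h2
    simp only [hX]
    rw [← h1, max_eq_left h2]
  have hXR : ∀ j, IdentDistrib (X j) R P P' := fun j =>
    ((IdentDistrib.of_ae_eq (hRs j) (hRX j)).symm).trans (hR.copies j)
  have hident : ∀ j, IdentDistrib (X j) (X 0) P P := fun j => (hXR j).trans (hXR 0).symm
  have hindep : iIndepFun X P := hR.iindep.congr hRX
  have hXM : IndepFun (fun ω j => X j ω) M' P := by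
    refine hR.indep.congr ?_ hMM'
    filter_upwards [ae_all_iff.2 hRX] with ω hω
    funext j
    exact hω j
  have hint : Integrable (X 0) P := (hXR 0).integrable_iff.2 hRint
  have hMd' : ∫⁻ ω, (M' ω : ENNReal) ∂P = ENNReal.ofReal d := by
    rw [← hMd]
    exact lintegral_congr_ae (hMM'.mono fun ω h => by simp only [h])
  have hS : (fun ω => ∑ j ∈ Finset.range (M ω), Rs j ω) =ᵐ[P]
      fun ω => ∑ j ∈ Finset.range (M' ω), X j ω := by
    filter_upwards [ae_all_iff.2 hRX, hMM'] with ω h1 h2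
    rw [h2]
    exact Finset.sum_congr rfl fun j _ => h1 j
  have hSm : Measurable fun ω => ∑ j ∈ Finset.range (M' ω), X j ω := by
    have h1 : Measurable fun z : ℕ × Ω => ∑ j ∈ Finset.range z.1, X j z.2 :=
      measurable_from_prod_countable_right fun n =>
        Finset.measurable_fun_sum (Finset.range n) fun j _ => hXm j
    exact h1.comp (hM'm.prodMk measurable_id)
  have hS0 : ∀ ω, 0 ≤ ∑ j ∈ Finset.range (M' ω), X j ω := fun ω =>
    Finset.sum_nonneg fun j _ => hX0 j ω
  have hlint : ∫⁻ ω, ENNReal.ofReal (∑ j ∈ Finset.range (M' ω), X j ω) ∂P =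
      ENNReal.ofReal (d * ∫ ω, X 0 ω ∂P) := by
    rw [lintegral_random_sum hXm hX0 hident hM'm hXM, hMd', ENNReal.ofReal_mul hd.le,
      ofReal_integral_eq_lintegral_ofReal hint (ae_of_all _ (hX0 0))]
  have hm0 : 0 ≤ ∫ ω, X 0 ω ∂P := integral_nonneg (hX0 0)
  have hSint : Integrable (fun ω => ∑ j ∈ Finset.range (M' ω), X j ω) P := by
    refine ⟨hSm.aestronglyMeasurable, ?_⟩
    rw [hasFiniteIntegral_iff_ofReal (ae_of_all _ hS0), hlint]
    exact ENNReal.ofReal_lt_top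
  have hSmean : ∫ ω, ∑ j ∈ Finset.range (M' ω), X j ω ∂P = d * ∫ ω, X 0 ω ∂P := by
    rw [integral_eq_lintegral_of_nonneg_ae (ae_of_all _ hS0) hSm.aestronglyMeasurable, hlint,
      ENNReal.toReal_ofReal (by positivity)]
  have heq : (fun ω => c / d * (∑ j ∈ Finset.range (M ω), Rs j ω) + (1 - c)) =ᵐ[P]
      fun ω => c / d * (∑ j ∈ Finset.range (M' ω), X j ω) + (1 - c) :=
    hS.mono fun ω h => by simp only [h]
  -- By Wald the equation gives m = c m + 1 - c with m finite, and c < 1 forces m = 1.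
  have hmean : ∫ ω, X 0 ω ∂P = 1 := by
    have h1 := (hXR 0).integral_eq.trans hR.eq.integral_eq
    rw [integral_congr_ae heq, integral_add (hSint.const_mul _) (integrable_const _),
      integral_const_mul, hSmean] at h1
    simp only [integral_const, probReal_univ, smul_eq_mul, one_mul] at h1
    have h2 : c / d * (d * ∫ ω, X 0 ω ∂P) = c * ∫ ω, X 0 ω ∂P := by field_simp
    rw [h2] at h1
    have h3 : (1 - c) * (∫ ω, X 0 ω ∂P - 1) = 0 := by linarith
    rcases mul_eq_zero.1 h3 with h | h <;> linarith
  have hcomp := compoundTail_of_indep hXm hX0 hindep hident hint hmean hM'm hXM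
    (hasSum_mul_measureReal_fiber hM'm hd.le hMd')
  have hU : tailFun P (fun ω => (M' ω : ℝ)) = tailFun P fun ω => (M ω : ℝ) := by
    funext x
    refine measureReal_congr ?_
    filter_upwards [hMM'] with ω h
    exact propext (by change x < (M' ω : ℝ) ↔ x < (M ω : ℝ); rw [h])
  have hV : tailFun P (X 0) = tailFun P' R := by
    funext x
    exact congrArg ENNReal.toReal ((hXR 0).measure_mem_eq (s := Set.Ioi x) measurableSet_Ioi)
  rw [hU, hV] at hcomp
  refine ⟨_, _, _, hcomp, fun x => ?_⟩
  have h1 : tailFun P' R (c / d * x + (1 - c)) =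
      tailFun P (fun ω => c / d * (∑ j ∈ Finset.range (M ω), Rs j ω) + (1 - c))
        (c / d * x + (1 - c)) :=
    congrArg ENNReal.toReal (hR.eq.measure_mem_eq (s := Set.Ioi _) measurableSet_Ioi)
  rw [h1]
  refine measureReal_congr ?_
  filter_upwards [hS] with ω h
  have hcd : 0 < c / d := by positivity
  refine propext ?_
  change c / d * x + (1 - c) < c / d * (∑ j ∈ Finset.range (M ω), Rs j ω) + (1 - c) ↔
    x < ∑ j ∈ Finset.range (M' ω), X j ω
  rw [h, add_lt_add_iff_right, mul_lt_mul_iff_right₀ hcd]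

theorem isEquivalent_const_mul_of_tendsto_div {f g : ℝ → ℝ} {k : ℝ} (hk : k ≠ 0)
    (h : Tendsto (fun x => f x / g x) atTop (𝓝 k)) : f ~[atTop] fun x => k * g x := by
  refine isEquivalent_of_tendsto_one ?_
  have h1 := h.div_const k
  rw [div_self hk] at h1
  refine h1.congr fun x => ?_
  rw [Pi.div_apply, div_div, mul_comm k]

theorem theorem3
    {Ω Ω' : Type*} [MeasurableSpace Ω] [MeasurableSpace Ω']
    (P : Measure Ω) [IsProbabilityMeasure P] (P' : Measure Ω') [IsProbabilityMeasure P']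
    (c d α : ℝ) (hc0 : 0 < c) (hc1 : c < 1) (hd : 1 ≤ d)
    (hα : 1 < α) (hαint : ∀ n : ℕ, α ≠ n)
    -- the time interval `T`, with mean `d`
    (T : Ω → ℝ≥0) (hT : Measurable T)
    (hTint : Integrable (fun ω => (T ω : ℝ)) P) (hTmean : ∫ ω, (T ω : ℝ) ∂P = d)
    -- the unit-rate Poisson process, independent of `T`
    (N : ℝ≥0 → Ω → ℕ) (hN : IsUnitPoissonProcess N P)
    (hNT : IndepFun (fun ω t => N t ω) T P)
    -- the nonnegative integrable solution `R` of the stochastic equation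
    (R : Ω' → ℝ) (hR0 : ∀ᵐ ω ∂P', 0 ≤ R ω) (hRint : Integrable R P')
    (Rs : ℕ → Ω → ℝ) (hR : SolvesPageRankEq c d (fun ω => N (T ω) ω) Rs P R P')
    -- the slowly varying function
    (L : ℝ → ℝ) (hL : IsSlowlyVarying L) :
    (tailFun P (fun ω => (N (T ω) ω : ℝ)) ~[atTop] fun x => x ^ (-α) * L x) ↔
      (tailFun P' R ~[atTop] fun x =>
        c ^ α / (d ^ α - c ^ α * d) * (x ^ (-α) * L x)) := by
  have hd0 : 0 < d := by linarith
  have hMd : ∫⁻ ω, (N (T ω) ω : ENNReal) ∂P = ENNReal.ofReal d := by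
    rw [hN.lintegral_comp hT hNT, ← hTmean,
      ofReal_integral_eq_lintegral_ofReal hTint (ae_of_all _ fun ω => (T ω).2)]
    simp
  obtain ⟨p, F, W, hcomp, heq⟩ := hR.exists_compoundTail hc0 hc1 hd0
    (hN.aemeasurable_comp hT) hMd hR0 hRint
  have hcα : 0 < c ^ α := Real.rpow_pos_of_pos hc0 α
  have hκ : (d / c) ^ α - d = (d ^ α - c ^ α * d) / c ^ α := by
    rw [Real.div_rpow hd0.le hc0.le]
    field_simp
  have hκ' : (c / d) ^ (-α) = (d / c) ^ α := by
    rw [Real.rpow_neg (by positivity), ← Real.inv_rpow (by positivity), inv_div]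
  -- Indeed (d/c)^α > d/c ≥ d, so the constant of the theorem is positive.
  have hκ0 : 0 < (d / c) ^ α - d := by
    have hdc : 1 < d / c := by rw [lt_div_iff₀ hc0]; linarith
    have h1 : (d / c) ^ (1 : ℝ) < (d / c) ^ α := Real.rpow_lt_rpow_of_exponent_lt hdc hα
    rw [Real.rpow_one] at h1
    have h2 : d ≤ d / c := by rw [le_div_iff₀ hc0]; nlinarith
    linarith
  have hK : c ^ α / (d ^ α - c ^ α * d) = 1 / ((d / c) ^ α - d) := by rw [hκ, one_div_div]
  rw [hK]
  have hK0 : 1 / ((d / c) ^ α - d) ≠ 0 := by positivity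
  constructor
  · intro h
    have hU : IsRVTail α (tailFun P fun ω => (N (T ω) ω : ℝ)) :=
      hL.isRVTail one_ne_zero (by simpa only [one_mul] using h) (tailFun_anti _)
        (fun _ => measureReal_nonneg) fun _ => measureReal_le_one
    exact (isEquivalent_const_mul_of_tendsto_div hK0
      (hcomp.tendsto_V_div_U hU hα hc0 hc1 hd heq)).trans (IsEquivalent.refl.mul h)
  · intro h
    have hV : IsRVTail α (tailFun P' R) :=
      hL.isRVTail hK0 h (tailFun_anti _) (fun _ => measureReal_nonneg)
        fun _ => measureReal_le_one
    have h1 := hcomp.tendsto_U_div_V hV hc0 hc1 hd heq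
    rw [hκ'] at h1
    refine (isEquivalent_const_mul_of_tendsto_div hκ0.ne' h1).trans ?_
    refine (IsEquivalent.refl.mul h).congr_right (Eventually.of_forall fun x => ?_)
    simp only [Pi.mul_apply]
    rw [← mul_assoc, mul_one_div_cancel hκ0.ne', one_mul]
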